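/- Let $\mathbb H$ be the real quaternions with norm $|\cdot|$, and let $\mathbb S=\{I\in\mathbb H:\operatorname{Re} I=0,\ |I|=1\}$. A function $f:\mathbb H\to\mathbb H$ is called left slice regular if it is real differentiable and, for every $I\in\mathbb S$ and all $x,y\in\mathbb R$, $$\tfrac12\Big(\frac{\partial}{\partial x}+I\frac{\partial}{\partial y}\Big)f(x+Iy)=0 .$$ For $I\in\mathbb S$ and $F\in L^1(\mathbb R,\mathbb H)$ put $$\mathscr F_I(F)(t)=\frac1{\sqrt{2\pi}}\int_{\mathbb R}e^{-Ixt}F(x)\,dx ;$$ for $F\in L^2(\mathbb R,\mathbb H)$ let $\mathscr F_I(F)\in L^2(\mathbb R,\mathbb H)$ be the Plancherel extension, i.e. the $L^2$-limit of $\mathscr F_I(F\mathbf 1_{[-R,R]})$ as $R\to\infty$. The support of a class of functions modulo null sets is the complement of the largest open set on which it vanishes almost everywhere. **Theorem.** Let $f:\mathbb H\to\mathbb H$ be left slice regular with $f|_{\mathbb R}\in L^2(\mathbb R)$, and let $A>0$. The following two conditions are equivalent: (i) there exists a constant $C$ such that $|f(\mathbf q)|\le Ce^{A|\mathbf q|}$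 for all $\mathbf q\in\mathbb H$; (ii) $\operatorname{supp}\mathscr F_I(f|_{\mathbb R})\subset[-A,A]$ for every $I\in\mathbb S$. Moreover, if one of these conditions holds, then for all $I\in\mathbb S$ and $x,y\in\mathbb R$ $$f(x+Iy)=\frac1{\sqrt{2\pi}}\int_{-A}^{A}e^{I(x+Iy)t}\,\mathscr F_I(f|_{\mathbb R})(t)\,dt ,$$ where the integral converges absolutely. -/

import Mathlib

open MeasureTheory Filter Topology
open scoped Quaternion

noncomputable section

/-- The unit sphere `𝕊` of purely imaginary quaternions. -/
def imagUnitSphere : Set ℍ := {q | q.re = 0 ∧ ‖q‖ = 1}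

/-- Left slice regularity of `f` on the open set `Ω ⊆ ℍ`: `f` is real differentiable on `Ω` and for
every `I ∈ 𝕊` the restriction of `f` to `ℂ_I` satisfies
`(1/2) (∂/∂x + I ∂/∂y) f (x + I y) = 0` on `Ω ∩ ℂ_I`. -/
def LeftSliceRegularOn (f : ℍ → ℍ) (Ω : Set ℍ) : Prop :=
  IsOpen Ω ∧ DifferentiableOn ℝ f Ω ∧
    ∀ I ∈ imagUnitSphere, ∀ x y : ℝ, (x : ℍ) + I * (y : ℍ) ∈ Ω →
      (1 / 2 : ℝ) • (deriv (fun s : ℝ => f ((s : ℍ) + I * (y : ℍ))) x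
        + I * deriv (fun s : ℝ => f ((x : ℍ) + I * (s : ℍ))) y) = 0

/-- The left-sided quaternion Fourier transform of an integrable function:
`(2π)^{-1/2} ∫ e^{-I x t} F(x) dx`. -/
def quaternionFourierIntegral (I : ℍ) (F : ℝ → ℍ) (t : ℝ) : ℍ :=
  (Real.sqrt (2 * Real.pi))⁻¹ •
    ∫ x : ℝ, NormedSpace.exp (-(I * (x : ℍ) * (t : ℍ))) * F x

/-- `G` is (a representative of) the Fourier transform of the square integrable function `F` in the
sense of Plancherel: `G` is square integrable and it is the `L²`-limit, as `R → ∞`, of the Fourier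
integrals of the truncations `F · 1_{[-R,R]}` (which lie in `L¹ ∩ L²`). -/
def IsPlancherelTransform (I : ℍ) (F G : ℝ → ℍ) : Prop :=
  MemLp G 2 volume ∧
    Tendsto (fun R : ℝ => eLpNorm (fun t : ℝ =>
        quaternionFourierIntegral I ((Set.Icc (-R) R).indicator F) t - G t) 2 volume)
      atTop (𝓝 0)

/-- The (essential) support of an a.e.-class of functions on `ℝ`: the complement of the largest open
set on which `G` vanishes almost everywhere. -/
def essentialSupport (G : ℝ → ℍ) : Set ℝ :=
  {t | ¬ ∃ U : Set ℝ, IsOpen U ∧ t ∈ U ∧ ∀ᵐ s ∂(volume : Measure ℝ), s ∈ U → G s = 0}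

section Existence

open FourierTransform SchwartzMap

theorem integrable_truncate {E : Type*} [NormedAddCommGroup E] {F : ℝ → E}
    (hF : MemLp F 2 volume) (R : ℝ) : Integrable ((Set.Icc (-R) R).indicator F) volume := by
  rw [integrable_indicator_iff measurableSet_Icc]
  have : MemLp F 2 (volume.restrict (Set.Icc (-R) R)) := hF.restrict _
  exact (this.mono_exponent (by norm_num)).integrable le_rfl

theorem tendsto_truncate {E : Type*} [NormedAddCommGroup E] {F : ℝ → E}
    (hF : MemLp F 2 volume) :
    Tendsto (fun R : ℝ => eLpNorm ((Set.Icc (-R) R).indicator F - F) 2 volume) atTop (𝓝 0) := by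
  have key : Tendsto (fun R : ℝ => ∫⁻ x, ‖((Set.Icc (-R) R).indicator F - F) x‖ₑ ^ (2 : ℝ))
      atTop (𝓝 (∫⁻ _ : ℝ, 0)) := by
    refine tendsto_lintegral_filter_of_dominated_convergence' (fun x => ‖F x‖ₑ ^ (2 : ℝ)) ?_ ?_ ?_ ?_
    · exact .of_forall fun R =>
        ((hF.1.indicator measurableSet_Icc).sub hF.1).enorm.pow_const _
    · refine .of_forall fun R => .of_forall fun x => ?_
      by_cases hx : x ∈ Set.Icc (-R) R <;> simp [hx]
    · have := lintegral_rpow_enorm_lt_top_of_eLpNorm_lt_top (by norm_num) (by norm_num) hF.2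
      simpa using this.ne
    · refine .of_forall fun x => tendsto_const_nhds.congr' ?_
      filter_upwards [eventually_ge_atTop |x|] with R hR
      have : x ∈ Set.Icc (-R) R := abs_le.1 hR
      simp [this]
  have := key.ennrpow_const (1 / 2)
  simpa [eLpNorm_eq_lintegral_rpow_enorm_toReal] using this

theorem imagUnit_mul_self {I : ℍ} (hI : I ∈ imagUnitSphere) : I * I = -1 := by
  obtain ⟨h0, h1⟩ := hI
  have h2 : star I = -I := by
    ext <;> simp [h0]
  have h3 := Quaternion.self_mul_star I
  rw [h2, Quaternion.normSq_eq_norm_mul_self, h1] at h3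
  have : -(I * I) = 1 := by simpa using h3
  rw [← this, neg_neg]

theorem norm_fourierKernel {I : ℍ} (hI : I ∈ imagUnitSphere) (x t : ℝ) :
    ‖NormedSpace.exp (-(I * (x : ℍ) * (t : ℍ)))‖ = 1 := by
  rw [Quaternion.norm_exp]
  have : (-(I * (x : ℍ) * (t : ℍ))).re = 0 := by
    simp [hI.1]
  rw [this]; simp

theorem continuous_fourierKernel (I : ℍ) :
    Continuous (fun p : ℝ × ℝ => NormedSpace.exp (-(I * (p.1 : ℍ) * (p.2 : ℍ)))) := by
  let +nondep : NormedAlgebra ℚ ℍ := .restrictScalars ℚ ℝ ℍ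
  have h := Quaternion.continuous_coe
  have h1 : Continuous fun p : ℝ × ℝ => (p.1 : ℍ) := h.comp continuous_fst
  have h2 : Continuous fun p : ℝ × ℝ => (p.2 : ℍ) := h.comp continuous_snd
  exact NormedSpace.exp_continuous.comp ((continuous_const.mul h1).mul h2).neg

theorem integrable_fourierKernel_mul {I : ℍ} (hI : I ∈ imagUnitSphere) {F : ℝ → ℍ}
    (hF : Integrable F volume) (t : ℝ) :
    Integrable (fun x : ℝ => NormedSpace.exp (-(I * (x : ℍ) * (t : ℍ))) * F x) volume := by
  refine hF.norm.mono' ?_ ?_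
  · refine AEStronglyMeasurable.mul ?_ hF.1
    have h := (continuous_fourierKernel I).comp (by fun_prop : Continuous fun x : ℝ => (x, t))
    exact h.aestronglyMeasurable
  · refine .of_forall fun x => ?_
    simp [norm_fourierKernel hI]

theorem continuous_quaternionFourierIntegral {I : ℍ} (hI : I ∈ imagUnitSphere) {F : ℝ → ℍ}
    (hF : Integrable F volume) : Continuous (quaternionFourierIntegral I F) := by
  have h : Continuous fun t : ℝ =>
      ∫ x : ℝ, NormedSpace.exp (-(I * (x : ℍ) * (t : ℍ))) * F x := by
    refine continuous_of_dominated (bound := fun x => ‖F x‖)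
      (fun t => (integrable_fourierKernel_mul hI hF t).1) ?_ hF.norm ?_
    · intro t
      refine .of_forall fun x => ?_
      simp [norm_fourierKernel hI]
    · refine .of_forall fun x => ?_
      exact ((continuous_fourierKernel I).comp
        (by fun_prop : Continuous fun t : ℝ => (x, t))).mul continuous_const
  exact Continuous.const_smul h ((Real.sqrt (2 * Real.pi))⁻¹ : ℝ)

theorem quaternionFourierIntegral_add {I : ℍ} (hI : I ∈ imagUnitSphere) {F F' : ℝ → ℍ}
    (hF : Integrable F volume) (hF' : Integrable F' volume) (t : ℝ) :
    quaternionFourierIntegral I (fun x => F x + F' x) t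
      = quaternionFourierIntegral I F t + quaternionFourierIntegral I F' t := by
  unfold quaternionFourierIntegral
  rw [← smul_add, ← integral_add (integrable_fourierKernel_mul hI hF t)
    (integrable_fourierKernel_mul hI hF' t)]
  simp only [mul_add]

theorem IsPlancherelTransform.add {I : ℍ} (hI : I ∈ imagUnitSphere) {F F' G G' : ℝ → ℍ}
    (hF : MemLp F 2 volume) (hF' : MemLp F' 2 volume)
    (h : IsPlancherelTransform I F G) (h' : IsPlancherelTransform I F' G') :
    IsPlancherelTransform I (fun x => F x + F' x) (fun t => G t + G' t) := by
  refine ⟨h.1.add h'.1, ?_⟩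
  refine tendsto_of_tendsto_of_tendsto_of_le_of_le tendsto_const_nhds
    (by simpa using h.2.add h'.2) (fun _ => bot_le) ?_
  intro R
  have hm := (continuous_quaternionFourierIntegral hI
    (integrable_truncate hF R)).aestronglyMeasurable (μ := volume)
  have hm' := (continuous_quaternionFourierIntegral hI
    (integrable_truncate hF' R)).aestronglyMeasurable (μ := volume)
  refine le_trans (le_of_eq ?_) (eLpNorm_add_le (hm.sub h.1.1) (hm'.sub h'.1.1) (by norm_num))
  have e : (Set.Icc (-R) R).indicator (fun x => F x + F' x)
      = fun x => (Set.Icc (-R) R).indicator F x + (Set.Icc (-R) R).indicator F' x :=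
    Set.indicator_add _ _ _
  have e' : (fun t : ℝ => quaternionFourierIntegral I
        ((Set.Icc (-R) R).indicator (fun x => F x + F' x)) t - (G t + G' t))
      = (quaternionFourierIntegral I ((Set.Icc (-R) R).indicator F) - G)
        + (quaternionFourierIntegral I ((Set.Icc (-R) R).indicator F') - G') := by
    ext1 t
    rw [e, quaternionFourierIntegral_add hI (integrable_truncate hF R) (integrable_truncate hF' R)]
    simp only [Pi.add_apply, Pi.sub_apply]
    exact add_sub_add_comm _ _ _ _
  exact congrArg (fun K => eLpNorm K 2 (volume : Measure ℝ)) e'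

theorem IsPlancherelTransform.ae_unique {I : ℍ} (hI : I ∈ imagUnitSphere) {F G G' : ℝ → ℍ}
    (hF : MemLp F 2 volume)
    (h : IsPlancherelTransform I F G) (h' : IsPlancherelTransform I F G') :
    G =ᵐ[volume] G' := by
  have key : eLpNorm (G' - G) 2 volume ≤ 0 := by
    refine ge_of_tendsto' (by simpa using h.2.add h'.2) fun R => ?_
    have hm := (continuous_quaternionFourierIntegral hI
      (integrable_truncate hF R)).aestronglyMeasurable (μ := volume)
    refine le_trans (le_of_eq ?_) (eLpNorm_sub_le (hm.sub h.1.1) (hm.sub h'.1.1) (by norm_num))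
    congr 1
    ext1 t
    simp
  have h0 := (eLpNorm_eq_zero_iff (h'.1.1.sub h.1.1) (by norm_num)).1 (le_antisymm key bot_le)
  filter_upwards [h0] with t ht
  exact (sub_eq_zero.1 ht).symm

theorem toLp_fourier_ae_eq {g : ℝ → ℂ} (h1 : Integrable g volume) (h2 : MemLp g 2 volume) :
    ((𝓕 (h2.toLp g) : Lp ℂ 2 (volume : Measure ℝ)) : ℝ → ℂ) =ᵐ[volume] 𝓕 g := by
  have hc : Continuous (𝓕 g) :=
    VectorFourier.fourierIntegral_continuous Real.continuous_fourierChar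
      (by exact continuous_inner) h1
  refine ae_eq_of_integral_contDiff_smul_eq
    ((Lp.memLp _).locallyIntegrable (by norm_num)) hc.locallyIntegrable ?_
  intro u hu hus
  let w : 𝓢(ℝ, ℂ) := (hus.comp_left (g := ((↑) : ℝ → ℂ)) Complex.ofReal_zero).toSchwartzMap
    (Complex.ofRealCLM.contDiff.comp hu)
  have hw : ∀ x, w x = (u x : ℂ) := fun x => rfl
  have e1 := congrArg (fun T => T w) (Lp.fourier_toTemperedDistribution_eq (h2.toLp g))
  simp only [TemperedDistribution.fourier_apply, Lp.toTemperedDistribution_apply] at e1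
  have e2 : ∫ x, (𝓕 w) x • (h2.toLp g : ℝ → ℂ) x = ∫ x, (𝓕 w) x • g x := by
    refine integral_congr_ae ?_
    filter_upwards [h2.coeFn_toLp] with x hx
    rw [hx]
  have e3 : ∫ x, (𝓕 (w : ℝ → ℂ)) x • g x = ∫ x, w x • (𝓕 g) x := by
    have := VectorFourier.integral_fourierIntegral_smul_eq_flip (L := innerₗ ℝ)
      Real.continuous_fourierChar continuous_inner (w.integrable (μ := volume)) h1
    rw [flip_innerₗ] at this
    exact this
  rw [e2, SchwartzMap.fourier_coe, e3] at e1
  simpa [hw] using e1.symm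

theorem eLpNorm_fourier_sub {g h : ℝ → ℂ} (h1 : Integrable g volume) (h2 : MemLp g 2 volume)
    (h3 : MemLp h 2 volume) :
    eLpNorm (fun t => 𝓕 g t - (𝓕 (h3.toLp h) : Lp ℂ 2 (volume : Measure ℝ)) t) 2 volume
      = eLpNorm (g - h) 2 volume := by
  have e1 : eLpNorm (fun t => 𝓕 g t - (𝓕 (h3.toLp h) : Lp ℂ 2 (volume : Measure ℝ)) t) 2 volume
      = ‖(𝓕 (h2.toLp g) - 𝓕 (h3.toLp h) : Lp ℂ 2 (volume : Measure ℝ))‖ₑ := by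
    rw [Lp.enorm_def]
    refine eLpNorm_congr_ae ?_
    filter_upwards [toLp_fourier_ae_eq h1 h2, Lp.coeFn_sub (𝓕 (h2.toLp g)) (𝓕 (h3.toLp h))]
      with t ht ht'
    rw [ht', Pi.sub_apply, ht]
  have e2 : (𝓕 (h2.toLp g) - 𝓕 (h3.toLp h) : Lp ℂ 2 (volume : Measure ℝ))
      = 𝓕 ((h2.sub h3).toLp (g - h)) := by
    rw [MemLp.toLp_sub h2 h3]
    exact ((Lp.fourierTransformₗᵢ ℝ ℂ).map_sub _ _).symm
  rw [e1, e2, ← Lp.enorm_toLp (hf := h2.sub h3)]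
  exact congrArg ENNReal.ofNNReal (Subtype.ext (Lp.norm_fourier_eq _))

theorem eLpNorm_comp_div {g : ℝ → ℂ} {c : ℝ} (hc : 0 < c) :
    eLpNorm (fun t => g (t / c)) 2 volume
      = (ENNReal.ofReal c) ^ (1 / 2 : ℝ) * eLpNorm g 2 volume := by
  have hc' : c⁻¹ ≠ 0 := inv_ne_zero hc.ne'
  have h := ((Homeomorph.mulRight₀ c⁻¹ hc').measurableEmbedding).eLpNorm_map_measure
    (g := g) (p := 2) (μ := (volume : Measure ℝ))
  simp only [Homeomorph.coe_mulRight₀] at h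
  rw [Real.map_volume_mul_right hc', eLpNorm_smul_measure_of_ne_top (by norm_num)] at h
  simp only [inv_inv, abs_of_pos hc] at h
  have e : (fun t => g (t / c)) = g ∘ fun x => x * c⁻¹ := by
    ext1 t; simp [div_eq_mul_inv]
  rw [e, ← h]
  simp

theorem isPlancherelTransform_component {I : ℍ} {h : ℝ → ℂ}
    (hh : MemLp h 2 volume) (φ : ℂ →ₐ[ℝ] ℍ) (hφ : φ Complex.I = I) (e : ℍ) :
    IsPlancherelTransform I (fun x => φ (h x) * e) (fun t => (Real.sqrt (2 * Real.pi))⁻¹ •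
      (φ ((𝓕 (hh.toLp h) : Lp ℂ 2 (volume : Measure ℝ)) (t / (2 * Real.pi))) * e)) := by
  have hpi : 0 < 2 * Real.pi := by positivity
  let ψ : ℂ →L[ℝ] ℍ := φ.toLinearMap.toContinuousLinearMap
  have hψ : ∀ z, φ z = ψ z := fun z => rfl
  set H : ℝ → ℂ := ((𝓕 (hh.toLp h) : Lp ℂ 2 (volume : Measure ℝ)) : ℝ → ℂ) with hH
  have hHm : MemLp H 2 volume := Lp.memLp _
  have hbound : ∀ z : ℂ, ‖(Real.sqrt (2 * Real.pi))⁻¹ • (φ z * e)‖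
      ≤ ((Real.sqrt (2 * Real.pi))⁻¹ * ‖ψ‖ * ‖e‖) * ‖z‖ := by
    intro z
    rw [norm_smul, norm_mul, Real.norm_of_nonneg (by positivity)]
    have := ψ.le_opNorm z
    rw [← hψ] at this
    calc _ ≤ (Real.sqrt (2 * Real.pi))⁻¹ * ((‖ψ‖ * ‖z‖) * ‖e‖) := by gcongr
      _ = _ := by ring
  have hkernel : ∀ x t : ℝ, NormedSpace.exp (-(I * (x : ℍ) * (t : ℍ)))
      = φ (Complex.exp (((-(x * t) : ℝ) : ℂ) * Complex.I)) := by
    intro x t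
    let +nondep : NormedAlgebra ℚ ℍ := .restrictScalars ℚ ℝ ℍ
    rw [Complex.exp_eq_exp_ℂ, NormedSpace.map_exp φ ψ.continuous, map_mul, hφ]
    congr 1
    have : φ ((-(x * t) : ℝ) : ℂ) = ((-(x * t) : ℝ) : ℍ) := φ.commutes _
    rw [this]
    have hc := Quaternion.coe_commutes (x * t) I
    push_cast at hc ⊢
    rw [mul_assoc, ← hc, neg_mul]
  have hint : ∀ (g : ℝ → ℂ), Integrable g volume → ∀ t : ℝ,
      quaternionFourierIntegral I (fun x => φ (g x) * e) t
        = (Real.sqrt (2 * Real.pi))⁻¹ • (φ (𝓕 g (t / (2 * Real.pi))) * e) := by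
    intro g hg t
    unfold quaternionFourierIntegral
    congr 1
    let L : ℂ →L[ℝ] ℍ := (ContinuousLinearMap.mul ℝ ℍ).flip e ∘L ψ
    have hL : ∀ z, φ z * e = L z := fun z => rfl
    rw [hL, Real.fourier_real_eq_integral_exp_smul, ← L.integral_comp_comm]
    · congr 1
      ext1 x
      rw [← hL, hkernel, ← mul_assoc, ← map_mul, smul_eq_mul]
      congr 4
      push_cast
      field_simp
    · refine hg.norm.mono' ?_ ?_
      · have hk : Continuous fun x : ℝ =>
            Complex.exp (((-2 * Real.pi * x * (t / (2 * Real.pi)) : ℝ) : ℂ) * Complex.I) := by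
          fun_prop
        exact hk.aestronglyMeasurable.smul hg.1
      · refine .of_forall fun x => ?_
        rw [norm_smul, Complex.norm_exp_ofReal_mul_I, one_mul]
  refine ⟨?_, ?_⟩
  · have hcomp : MemLp (fun t => H (t / (2 * Real.pi))) 2 volume := by
      refine ⟨?_, ?_⟩
      · have hmap : AEStronglyMeasurable H
            (Measure.map (fun x : ℝ => x * (2 * Real.pi)⁻¹) volume) := by
          rw [Real.map_volume_mul_right (inv_ne_zero hpi.ne')]
          exact hHm.1.smul_measure _
        have h' := hmap.comp_aemeasurable (by fun_prop)
        exact h'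
      · rw [eLpNorm_comp_div hpi]
        exact ENNReal.mul_lt_top
          (ENNReal.rpow_lt_top_of_nonneg (by norm_num) ENNReal.ofReal_ne_top) hHm.2
    refine hcomp.of_le_mul (c := (Real.sqrt (2 * Real.pi))⁻¹ * ‖ψ‖ * ‖e‖) ?_
      (.of_forall fun t => hbound _)
    have : Continuous fun z : ℂ => (Real.sqrt (2 * Real.pi))⁻¹ • (φ z * e) :=
      Continuous.const_smul (g := fun z : ℂ => φ z * e) (ψ.continuous.mul continuous_const)
        ((Real.sqrt (2 * Real.pi))⁻¹ : ℝ)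
    exact this.comp_aestronglyMeasurable hcomp.1
  · set c : ℝ := (Real.sqrt (2 * Real.pi))⁻¹ * ‖ψ‖ * ‖e‖
    have hlim := ENNReal.Tendsto.const_mul (a := ENNReal.ofReal c *
        (ENNReal.ofReal (2 * Real.pi)) ^ (1 / 2 : ℝ)) (tendsto_truncate hh)
      (.inr (ENNReal.mul_ne_top ENNReal.ofReal_ne_top
        (ENNReal.rpow_ne_top_of_nonneg (by norm_num) ENNReal.ofReal_ne_top)))
    rw [mul_zero] at hlim
    refine tendsto_of_tendsto_of_tendsto_of_le_of_le tendsto_const_nhds hlim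
      (fun _ => bot_le) ?_
    intro R
    have hR := integrable_truncate hh R
    have hR2 : MemLp ((Set.Icc (-R) R).indicator h) 2 volume := hh.indicator measurableSet_Icc
    have e1 : (Set.Icc (-R) R).indicator (fun x => φ (h x) * e)
        = fun x => φ ((Set.Icc (-R) R).indicator h x) * e := by
      ext1 x
      by_cases hx : x ∈ Set.Icc (-R) R <;> simp [hx]
    have e2 := eLpNorm_comp_div (g := fun t => 𝓕 ((Set.Icc (-R) R).indicator h) t - H t) hpi
    rw [eLpNorm_fourier_sub hR hR2 hh] at e2
    simp only
    rw [mul_assoc, ← e2]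
    refine eLpNorm_le_mul_eLpNorm_of_ae_le_mul (.of_forall fun t => ?_) _
    rw [e1, hint _ hR, ← smul_sub, ← sub_mul, ← map_sub]
    exact hbound _

theorem exists_isPlancherelTransform {I : ℍ} (hI : I ∈ imagUnitSphere) {F : ℝ → ℍ}
    (hF : MemLp F 2 volume) : ∃ G : ℝ → ℍ, IsPlancherelTransform I F G := by
  let φ : ℂ →ₐ[ℝ] ℍ := Complex.lift ⟨I, imagUnit_mul_self hI⟩
  have hφ : φ Complex.I = I := by simp [φ]
  have hφr : ∀ r : ℝ, φ (r : ℂ) = (r : ℍ) := fun r => φ.commutes r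
  have hm : ∀ p : ℍ → ℝ, Continuous p → (∀ q, ‖p q‖ ≤ ‖q‖) →
      MemLp (fun x => ((p (F x) : ℝ) : ℂ)) 2 volume := by
    intro p hp hle
    refine hF.of_le ((Complex.continuous_ofReal.comp hp).comp_aestronglyMeasurable hF.1)
      (.of_forall fun x => ?_)
    simpa using hle (F x)
  have hn : ∀ q : ℍ, ‖q‖ ^ 2 = q.re ^ 2 + q.imI ^ 2 + q.imJ ^ 2 + q.imK ^ 2 := by
    intro q
    rw [← Quaternion.normSq_def', Quaternion.normSq_eq_norm_mul_self, sq]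
  have c0 := hm (fun q => q.re) Quaternion.continuous_re fun q =>
    abs_le_of_sq_le_sq (by nlinarith [hn q, sq_nonneg q.imI, sq_nonneg q.imJ, sq_nonneg q.imK])
      (norm_nonneg q)
  have c1 := hm (fun q => q.imI) Quaternion.continuous_imI fun q =>
    abs_le_of_sq_le_sq (by nlinarith [hn q, sq_nonneg q.re, sq_nonneg q.imJ, sq_nonneg q.imK])
      (norm_nonneg q)
  have c2 := hm (fun q => q.imJ) Quaternion.continuous_imJ fun q =>
    abs_le_of_sq_le_sq (by nlinarith [hn q, sq_nonneg q.imI, sq_nonneg q.re, sq_nonneg q.imK])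
      (norm_nonneg q)
  have c3 := hm (fun q => q.imK) Quaternion.continuous_imK fun q =>
    abs_le_of_sq_le_sq (by nlinarith [hn q, sq_nonneg q.imI, sq_nonneg q.imJ, sq_nonneg q.re])
      (norm_nonneg q)
  have hmul : ∀ {h : ℝ → ℂ}, MemLp h 2 volume → ∀ e : ℍ, MemLp (fun x => φ (h x) * e) 2 volume := by
    intro h hh e
    let L : ℂ →L[ℝ] ℍ :=
      (ContinuousLinearMap.mul ℝ ℍ).flip e ∘L φ.toLinearMap.toContinuousLinearMap
    exact L.comp_memLp' hh
  let e1 : ℍ := ⟨0, 1, 0, 0⟩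
  let e2 : ℍ := ⟨0, 0, 1, 0⟩
  let e3 : ℍ := ⟨0, 0, 0, 1⟩
  have t0 := isPlancherelTransform_component c0 φ hφ 1
  have t1 := isPlancherelTransform_component c1 φ hφ e1
  have t2 := isPlancherelTransform_component c2 φ hφ e2
  have t3 := isPlancherelTransform_component c3 φ hφ e3
  have t := ((t0.add hI (hmul c0 _) (hmul c1 _) t1).add hI ((hmul c0 _).add (hmul c1 _))
    ((hmul c2 _).add (hmul c3 _)) (t2.add hI (hmul c2 _) (hmul c3 _) t3))
  have e : F = fun x => ((fun x => φ ((F x).re : ℂ) * 1) +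
      fun x => φ ((F x).imI : ℂ) * e1) x +
      ((fun x => φ ((F x).imJ : ℂ) * e2) +
      fun x => φ ((F x).imK : ℂ) * e3) x := by
    ext1 x
    simp only [hφr, Pi.add_apply]
    have h1 : e1.re = 0 ∧ e1.imI = 1 ∧ e1.imJ = 0 ∧ e1.imK = 0 := ⟨rfl, rfl, rfl, rfl⟩
    have h2 : e2.re = 0 ∧ e2.imI = 0 ∧ e2.imJ = 1 ∧ e2.imK = 0 := ⟨rfl, rfl, rfl, rfl⟩
    have h3 : e3.re = 0 ∧ e3.imI = 0 ∧ e3.imJ = 0 ∧ e3.imK = 1 := ⟨rfl, rfl, rfl, rfl⟩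
    clear_value e1 e2 e3
    ext <;> simp [Quaternion.re_mul, Quaternion.imI_mul, Quaternion.imJ_mul, Quaternion.imK_mul,
      h1, h2, h3]
  rw [← e] at t
  exact ⟨_, t⟩

end Existence

/-- The Fourier transform `𝓕_I F` of a square integrable `F : ℝ → ℍ`, defined (up to null sets) by
Plancherel's theorem. -/
def quaternionFourierL2 (I : ℍ) (F : ℝ → ℍ) (hI : I ∈ imagUnitSphere)
    (hF : MemLp F 2 volume) : ℝ → ℍ :=
  (exists_isPlancherelTransform hI hF).choose

theorem quaternionFourierL2_spec (I : ℍ) (F : ℝ → ℍ) (hI : I ∈ imagUnitSphere)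
    (hF : MemLp F 2 volume) : IsPlancherelTransform I F (quaternionFourierL2 I F hI hF) :=
  (exists_isPlancherelTransform hI hF).choose_spec

end

section

open FourierTransform SchwartzMap
open scoped ContDiff

/-! The theorem reduces to the classical Paley–Wiener theorem on each slice. Fix `I` and a unit `J`
orthogonal to it; then ℍ = ℂ_I ⊕ ℂ_I J, and f on ℂ_I splits as F₁ + F₂J with F₁, F₂ entire functions
of one complex variable (`LeftSliceRegularOn.differentiable_sliceComponent`,
`apply_sliceEmbedding_eq`). The kernel e^{-Ixt} lies in ℂ_I and acts from the left, so the
quaternionic transform is, up to t = 2πξ and a constant, the pair of complex transforms of F₁ and F₂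
(`quaternionFourierL2_ae_eq`).

Growth implies support. Let g be entire of exponential type A and L² on ℝ. If g is bounded on ℝ,
Phragmén–Lindelöf gives |g(z)| ≤ M e^{A|Im z|} in the lower half-plane. Regularise by (1 + iδz)⁻²,
push the contour down for frequencies t > A, and let δ → 0
(`integral_mul_fourier_eq_zero_of_bounded_on_real`). In general g is replaced by the averages ∫₀ʰ
g(z + s) ds, which are bounded on ℝ; differentiating at h = 0 recovers g
(`integral_mul_fourier_modulatedBump_eq_zero`). Negative frequencies follow from z ↦ -z.

Support implies growth and the formula. A transform supported in a bounded band is integrable, so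
the inversion integral is entire. It agrees with g on ℝ, hence on ℂ (`eq_integral_exp_mul_fourier`).
Cauchy–Schwarz on the band bounds it by e^{A|Im z|} times a constant controlled by the L² norm of f
on ℝ, uniformly in `I` (`exists_exponential_bound`). -/

/-- Cauchy's estimate turns a locally uniform bound on the integrand into one on its derivative, so
only `F` itself has to be dominated. -/
theorem differentiable_integral_of_differentiable {α : Type*} [MeasurableSpace α] {μ : Measure α}
    {F : ℂ → α → ℂ} (hm : ∀ z, AEStronglyMeasurable (F z) μ)
    (hd : ∀ a, Differentiable ℂ fun z => F z a) (b : ℝ → α → ℝ)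
    (hb : ∀ R, Integrable (b R) μ) (hF : ∀ R, ∀ᵐ a ∂μ, ∀ z, ‖z‖ ≤ R → ‖F z a‖ ≤ b R a) :
    Differentiable ℂ fun z => ∫ a, F z a ∂μ := by
  intro z₀
  have hint : Integrable (F z₀) μ := (hb ‖z₀‖).mono' (hm z₀) ((hF ‖z₀‖).mono fun a h => h z₀ le_rfl)
  -- The derivative is measurable as a pointwise limit of difference quotients with increments
  -- 1/(n+1).
  have hm' : AEStronglyMeasurable (fun a => deriv (fun z => F z a) z₀) μ := by
    have hlim : Tendsto (fun n : ℕ => ((n : ℝ) + 1)⁻¹) atTop (𝓝[≠] 0) := by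
      refine tendsto_nhdsWithin_iff.2 ⟨?_, .of_forall fun n => ?_⟩
      · simpa using tendsto_one_div_add_atTop_nhds_zero_nat (𝕜 := ℝ)
      · have : (0 : ℝ) < ((n : ℝ) + 1)⁻¹ := by positivity
        exact this.ne'
    have hlim' : Tendsto (fun n : ℕ => ((((n : ℝ) + 1)⁻¹ : ℝ) : ℂ)) atTop (𝓝[≠] 0) := by
      refine tendsto_nhdsWithin_iff.2 ⟨?_, .of_forall fun n => ?_⟩
      · exact (Complex.continuous_ofReal.tendsto' 0 0 (by simp)).comp
          (tendsto_nhdsWithin_iff.1 hlim).1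
      · have : (0 : ℝ) < ((n : ℝ) + 1)⁻¹ := by positivity
        simpa using Complex.ofReal_ne_zero.2 this.ne'
    refine aestronglyMeasurable_of_tendsto_ae (u := atTop)
      (f := fun (n : ℕ) a => ((((n : ℝ) + 1)⁻¹ : ℝ) : ℂ)⁻¹ •
        (F (z₀ + ((((n : ℝ) + 1)⁻¹ : ℝ) : ℂ)) a - F z₀ a)) ?_ ?_
    · intro n
      exact AEStronglyMeasurable.const_mul ((hm _).sub (hm _)) _
    · refine .of_forall fun a => ?_
      exact ((hasDerivAt_iff_tendsto_slope_zero.1 ((hd a z₀).hasDerivAt))).comp hlim'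
  -- The radius ‖z₀‖ + 2 contains every unit circle centred in the unit ball about z₀.
  refine (hasDerivAt_integral_of_dominated_loc_of_deriv_le (bound := b (‖z₀‖ + 2))
    (F' := fun z a => deriv (fun z => F z a) z) (Metric.ball_mem_nhds z₀ one_pos)
    (.of_forall hm) hint hm' ?_ (hb _) ?_).2.differentiableAt
  · filter_upwards [hF (‖z₀‖ + 2)] with a ha z hz
    have := Complex.norm_deriv_le_of_forall_mem_sphere_norm_le (c := z) (R := 1)
      (C := b (‖z₀‖ + 2) a) one_pos (hd a).diffContOnCl fun w hw => ha w ?_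
    · simpa using this
    · have h1 : ‖z - z₀‖ < 1 := by simpa [dist_eq_norm] using hz
      have h2 : ‖w - z‖ = 1 := by simpa [dist_eq_norm] using hw
      calc ‖w‖ = ‖(w - z) + (z - z₀) + z₀‖ := by ring_nf
        _ ≤ ‖w - z‖ + ‖z - z₀‖ + ‖z₀‖ := norm_add₃_le
        _ ≤ _ := by linarith
  · exact .of_forall fun a z _ => (hd a z).hasDerivAt

/-- The sliding integral `∫₀ʰ g (z + s) ds`. -/
noncomputable def slidingIntegral (g : ℂ → ℂ) (h : ℝ) (z : ℂ) : ℂ :=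
  ∫ s in Set.Ioc 0 h, g (z + (s : ℂ))

theorem norm_add_ofReal_le {z : ℂ} {s h : ℝ} (hs : s ∈ Set.Ioc 0 h) : ‖z + (s : ℂ)‖ ≤ ‖z‖ + h := by
  refine (norm_add_le _ _).trans ?_
  rw [Complex.norm_real, Real.norm_of_nonneg hs.1.le]
  linarith [hs.2]

/-! ### Sliding averages and the Phragmén–Lindelöf bound -/

section ExponentialType

variable {g : ℂ → ℂ} {A C : ℝ}

theorem differentiable_slidingIntegral (hg : Differentiable ℂ g) (hA : 0 ≤ A) (hC : 0 ≤ C)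
    (hgC : ∀ z, ‖g z‖ ≤ C * Real.exp (A * ‖z‖)) (h : ℝ) :
    Differentiable ℂ (slidingIntegral g h) := by
  refine differentiable_integral_of_differentiable (fun z => ?_) (fun s => ?_)
    (fun R _ => C * Real.exp (A * (R + h))) (fun R => ?_) (fun R => ?_)
  · exact (hg.continuous.comp (by fun_prop)).aestronglyMeasurable
  · exact hg.comp (by fun_prop)
  · exact integrable_const _
  · filter_upwards [ae_restrict_mem measurableSet_Ioc] with s hs z hz
    refine (hgC _).trans ?_
    have := norm_add_ofReal_le (z := z) hs
    gcongr
    linarith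

theorem norm_slidingIntegral_le (hA : 0 ≤ A) (hC : 0 ≤ C)
    (hgC : ∀ z, ‖g z‖ ≤ C * Real.exp (A * ‖z‖)) {h : ℝ} (hh : 0 ≤ h) (z : ℂ) :
    ‖slidingIntegral g h z‖ ≤ (C * Real.exp (A * h) * h) * Real.exp (A * ‖z‖) := by
  have := norm_setIntegral_le_of_norm_le_const (μ := volume) (s := Set.Ioc 0 h)
    (f := fun s : ℝ => g (z + (s : ℂ))) (C := C * Real.exp (A * (‖z‖ + h))) (by simp) ?_
  · refine this.trans (le_of_eq ?_)
    simp only [measureReal_def, Real.volume_Ioc, sub_zero, ENNReal.toReal_ofReal hh, mul_add,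
      Real.exp_add]
    ring
  · intro s hs
    refine (hgC _).trans ?_
    have := norm_add_ofReal_le (z := z) hs
    gcongr

/-- This is the purpose of averaging: |g| ≤ 1 + |g|² turns square integrability into a bound uniform
in x, which g itself is not yet known to satisfy. -/
theorem norm_slidingIntegral_ofReal_le
    (hL : MemLp (fun x : ℝ => g x) 2 volume) {h : ℝ} (hh : 0 ≤ h) (x : ℝ) :
    ‖slidingIntegral g h x‖ ≤ h + ∫ y : ℝ, ‖g y‖ ^ 2 := by
  have hsq : Integrable (fun y : ℝ => ‖g y‖ ^ 2) volume := hL.integrable_norm_pow two_ne_zero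
  have hsq' : Integrable (fun s : ℝ => ‖g (x + s : ℝ)‖ ^ 2) volume := hsq.comp_add_left x
  calc ‖slidingIntegral g h x‖ ≤ ∫ s in Set.Ioc 0 h, ‖g (x + (s : ℂ))‖ :=
        norm_integral_le_integral_norm _
    _ ≤ ∫ s in Set.Ioc 0 h, (1 + ‖g (x + s : ℝ)‖ ^ 2) := by
        refine integral_mono_of_nonneg (.of_forall fun _ => norm_nonneg _)
          ((integrable_const _).add hsq'.integrableOn) (.of_forall fun s => ?_)
        simp only [Complex.ofReal_add]
        nlinarith [sq_nonneg (‖g (x + (s : ℂ))‖ - 1), norm_nonneg (g (x + (s : ℂ)))]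
    _ = h + ∫ s in Set.Ioc 0 h, ‖g (x + s : ℝ)‖ ^ 2 := by
        rw [integral_add (integrable_const _) hsq'.integrableOn]
        simp [measureReal_def, hh]
    _ ≤ h + ∫ s, ‖g (x + s : ℝ)‖ ^ 2 := by
        gcongr
        exact .of_forall fun _ => sq_nonneg _
        exact Measure.restrict_le_self
    _ = _ := by
        rw [integral_add_left_eq_self (fun y : ℝ => ‖g y‖ ^ 2) x]

/-- The rotation w = iz carries the lower half-plane to the right one. There g(-iw)e^{-Aw} is
bounded by M on the imaginary axis, bounded on the positive axis, and of order 1, so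
Phragmén–Lindelöf applies. -/
theorem norm_le_of_bounded_on_real_of_exponential_type (hg : Differentiable ℂ g) (hA : 0 ≤ A)
    (hgC : ∀ z, ‖g z‖ ≤ C * Real.exp (A * ‖z‖)) {M : ℝ} (hM : ∀ x : ℝ, ‖g x‖ ≤ M) {z : ℂ}
    (hz : z.im ≤ 0) : ‖g z‖ ≤ M * Real.exp (-A * z.im) := by
  have key := PhragmenLindelof.right_half_plane_of_bounded_on_real (C := M) (z := Complex.I * z)
    (f := fun w => g (-Complex.I * w) * Complex.exp (-A * w)) ?_ ?_ ?_ ?_ (by simpa using hz)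
  · have e1 : -Complex.I * (Complex.I * z) = z := by
      rw [← mul_assoc, neg_mul, Complex.I_mul_I]; simp
    rw [e1, norm_mul, Complex.norm_exp] at key
    have e2 : (-A * (Complex.I * z)).re = A * z.im := by simp
    rw [e2] at key
    rw [neg_mul, Real.exp_neg, ← div_eq_mul_inv, le_div_iff₀ (Real.exp_pos _)]
    exact key
  · exact ((hg.comp (by fun_prop)).mul (by fun_prop)).diffContOnCl
  · refine ⟨1, by norm_num, 2 * A, ?_⟩
    refine Asymptotics.IsBigO.of_bound C (.of_forall fun w => ?_)
    rw [norm_mul, Complex.norm_exp, Real.rpow_one, Real.norm_of_nonneg (Real.exp_pos _).le]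
    have h1 := hgC (-Complex.I * w)
    have h2 : (-A * w).re ≤ A * ‖w‖ := by
      have := Complex.abs_re_le_norm w
      have h3 := (abs_le.1 this).1
      simp only [Complex.mul_re, Complex.neg_re, Complex.ofReal_re, Complex.neg_im,
        Complex.ofReal_im]
      nlinarith
    simp only [norm_mul, norm_neg, Complex.norm_I, one_mul] at h1
    calc _ ≤ (C * Real.exp (A * ‖w‖)) * Real.exp (A * ‖w‖) := by
          gcongr
          exact (norm_nonneg _).trans h1
      _ = _ := by rw [mul_assoc, ← Real.exp_add]; ring_nf
  · refine isBoundedUnder_of_eventually_le (a := C) ?_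
    filter_upwards [eventually_ge_atTop 0] with x hx
    have h1 := hgC (-Complex.I * x)
    simp only [norm_mul, norm_neg, Complex.norm_I, one_mul, Complex.norm_real,
      Real.norm_of_nonneg hx] at h1
    rw [norm_mul, Complex.norm_exp]
    have e2 : (-A * (x : ℂ)).re = -(A * x) := by simp
    rw [e2, Real.exp_neg, ← div_eq_mul_inv, div_le_iff₀ (Real.exp_pos _)]
    exact h1
  · intro x
    rw [norm_mul, Complex.norm_exp]
    have e1 : -Complex.I * (x * Complex.I) = x := by
      rw [mul_comm (x : ℂ), ← mul_assoc, neg_mul, Complex.I_mul_I]; simp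
    rw [e1]
    simpa using hM x

end ExponentialType

/-! ### Vanishing of regularised Fourier integrals by contour shift -/

section ContourShift

/-- The real part 1 - δ Im z is at least 1 in the lower half-plane. Hence (1 + iδz)⁻² has no pole
there and decays quadratically in Re z. -/
theorem one_add_sq_le_norm_sq {δ : ℝ} (hδ : 0 ≤ δ) {z : ℂ} (hz : z.im ≤ 0) :
    1 + (δ * z.re) ^ 2 ≤ ‖1 + Complex.I * δ * z‖ ^ 2 := by
  rw [Complex.sq_norm, Complex.normSq_apply]
  simp only [Complex.add_re, Complex.one_re, Complex.mul_re, Complex.I_re, Complex.ofReal_re,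
    zero_mul, Complex.I_im, Complex.ofReal_im, mul_zero, sub_self, Complex.mul_im, one_mul,
    zero_add, Complex.add_im, Complex.one_im, zero_sub]
  nlinarith [mul_nonneg hδ (neg_nonneg.2 hz)]

theorem integrable_inv_one_add_mul_sq {δ : ℝ} (hδ : 0 < δ) (M : ℝ) :
    Integrable (fun x : ℝ => M * (1 + (δ * x) ^ 2)⁻¹) volume :=
  (integrable_inv_one_add_sq.comp_mul_left' hδ.ne').const_mul M

variable {u : ℂ → ℂ} {A M t δ : ℝ}

theorem norm_mul_inv_sq_mul_exp_le (hM : 0 ≤ M)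
    (hu : ∀ z : ℂ, z.im ≤ 0 → ‖u z‖ ≤ M * Real.exp (-A * z.im)) (hδ : 0 ≤ δ)
    {z : ℂ} (hz : z.im ≤ 0) :
    ‖u z * ((1 + Complex.I * δ * z) ^ 2)⁻¹ * Complex.exp (-(Complex.I * t * z))‖
      ≤ M * (1 + (δ * z.re) ^ 2)⁻¹ * Real.exp ((t - A) * z.im) := by
  have h1 := one_add_sq_le_norm_sq hδ hz
  have h2 : 0 < 1 + (δ * z.re) ^ 2 := by positivity
  rw [norm_mul, norm_mul, norm_inv, norm_pow, Complex.norm_exp]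
  have e : (-(Complex.I * t * z)).re = t * z.im := by simp
  rw [e]
  calc _ ≤ (M * Real.exp (-A * z.im)) * (1 + (δ * z.re) ^ 2)⁻¹ * Real.exp (t * z.im) := by
        gcongr
        exact hu z hz
    _ = M * (1 + (δ * z.re) ^ 2)⁻¹ * (Real.exp (-A * z.im) * Real.exp (t * z.im)) := by ring
    _ = _ := by rw [← Real.exp_add]; ring_nf

/-- Cauchy's theorem on the rectangle [-R, R] × [-R, 0]: the bottom edge contributes O(R
e^{-(t-A)R}) and the vertical edges O(R/(1 + (δR)²)), and both tend to 0. -/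
theorem integral_mul_inv_sq_mul_exp_eq_zero (hd : Differentiable ℂ u) (hM : 0 ≤ M)
    (hu : ∀ z : ℂ, z.im ≤ 0 → ‖u z‖ ≤ M * Real.exp (-A * z.im)) (hδ : 0 < δ) (ht : A < t) :
    ∫ x : ℝ, u x * ((1 + Complex.I * δ * x) ^ 2)⁻¹ * Complex.exp (-(Complex.I * t * x)) = 0 := by
  set H : ℂ → ℂ := fun z => u z * ((1 + Complex.I * δ * z) ^ 2)⁻¹ *
    Complex.exp (-(Complex.I * t * z)) with hH
  have hb : ∀ z : ℂ, z.im ≤ 0 →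
      ‖H z‖ ≤ M * (1 + (δ * z.re) ^ 2)⁻¹ * Real.exp ((t - A) * z.im) := fun z hz =>
    norm_mul_inv_sq_mul_exp_le hM hu hδ.le hz
  have hdiff : DifferentiableOn ℂ H {z | z.im ≤ 0} := by
    have h0 : ∀ z ∈ {z : ℂ | z.im ≤ 0}, (1 + Complex.I * δ * z) ^ 2 ≠ 0 := by
      intro z hz h
      have := one_add_sq_le_norm_sq hδ.le (z := z) hz
      rw [← norm_pow, h, norm_zero] at this
      nlinarith [sq_nonneg (δ * z.re)]
    refine (hd.differentiableOn.mul (DifferentiableOn.inv ?_ h0)).mul ?_ <;> fun_prop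
  have hcont : Continuous fun x : ℝ => H x := by
    have h1 : ContinuousOn H {z | z.im ≤ 0} := hdiff.continuousOn
    exact h1.comp_continuous Complex.continuous_ofReal (by simp)
  have hint : Integrable (fun x : ℝ => H x) volume := by
    refine (integrable_inv_one_add_mul_sq hδ M).mono' hcont.aestronglyMeasurable
      (.of_forall fun x => ?_)
    simpa using hb x (by simp)
  have hlim := intervalIntegral_tendsto_integral hint tendsto_neg_atTop_atBot tendsto_id
  refine tendsto_nhds_unique hlim ?_
  have hbound : ∀ R : ℝ, 0 ≤ R → ‖∫ x in (-R)..R, H x‖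
      ≤ 2 * (M * (R * Real.exp (-(t - A) * R))) + 2 * (M * (R * (1 + (δ * R) ^ 2)⁻¹)) := by
    intro R hR
    have hrect := Complex.integral_boundary_rect_eq_zero_of_differentiableOn H
      (⟨-R, -R⟩ : ℂ) (⟨R, 0⟩ : ℂ) (hdiff.mono ?_)
    · simp only at hrect
      have e : ∫ x in (-R)..R, H x = (∫ x in (-R)..R, H (x + (-R : ℝ) * Complex.I))
          + Complex.I • (∫ y in (-R)..0, H (R + y * Complex.I))
          - Complex.I • (∫ y in (-R)..0, H ((-R : ℝ) + y * Complex.I)) := by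
        simp only [Complex.ofReal_zero, zero_mul, add_zero] at hrect
        linear_combination (exp := 1) -hrect
      -- On the bottom edge only the exponential decay is kept; on the vertical edges (`b2`) only
      -- the quadratic decay.
      have b1 : ‖∫ x in (-R)..R, H (x + (-R : ℝ) * Complex.I)‖
          ≤ (M * Real.exp (-(t - A) * R)) * |R - -R| := by
        refine intervalIntegral.norm_integral_le_of_norm_le_const fun x _ => ?_
        refine (hb _ (by simpa using hR)).trans ?_
        have : (1 + (δ * (x + (-R : ℝ) * Complex.I : ℂ).re) ^ 2)⁻¹ ≤ 1 :=
          inv_le_one_of_one_le₀ (by nlinarith [sq_nonneg (δ * (x + (-R : ℝ) * Complex.I : ℂ).re)])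
        have e3 : (t - A) * (x + (-R : ℝ) * Complex.I : ℂ).im = -(t - A) * R := by simp; ring
        rw [e3]
        gcongr
        exact mul_le_of_le_one_right hM this
      have b2 : ∀ r : ℝ, r ^ 2 = R ^ 2 → ‖∫ y in (-R)..0, H (r + y * Complex.I)‖
          ≤ (M * (1 + (δ * R) ^ 2)⁻¹) * |0 - -R| := by
        intro r hr
        refine intervalIntegral.norm_integral_le_of_norm_le_const fun y hy => ?_
        have hy0 : y ≤ 0 := by
          rw [Set.uIoc_of_le (by linarith)] at hy
          exact hy.2
        refine (hb _ (by simpa using hy0)).trans ?_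
        have e3 : (r + y * Complex.I : ℂ).re = r := by simp
        have e4 : (r + y * Complex.I : ℂ).im = y := by simp
        rw [e3, e4, mul_pow, mul_pow, hr]
        refine mul_le_of_le_one_right (by positivity) (Real.exp_le_one_iff.2 ?_)
        exact mul_nonpos_of_nonneg_of_nonpos (by linarith) hy0
      rw [e]
      refine (norm_sub_le _ _).trans ((add_le_add_left (norm_add_le _ _) _).trans ?_)
      rw [norm_smul, norm_smul, Complex.norm_I, one_mul, one_mul]
      have b3 := b2 R rfl
      have b4 := b2 (-R) (by ring)
      rw [abs_of_nonneg (by linarith)] at b1 b3 b4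
      linarith
    · intro z hz
      have := hz.2
      simp only [Set.mem_preimage, Set.uIcc_of_le (by linarith : -R ≤ 0)] at this
      exact this.2
  have hR1 : Tendsto (fun R : ℝ => R * Real.exp (-(t - A) * R)) atTop (𝓝 0) := by
    simpa using tendsto_rpow_mul_exp_neg_mul_atTop_nhds_zero 1 (t - A) (by linarith)
  have hR2 : Tendsto (fun R : ℝ => R * (1 + (δ * R) ^ 2)⁻¹) atTop (𝓝 0) := by
    have h3 : Tendsto (fun R : ℝ => (δ ^ 2)⁻¹ * R⁻¹) atTop (𝓝 0) := by
      simpa using tendsto_inv_atTop_zero.const_mul (δ ^ 2)⁻¹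
    refine tendsto_of_tendsto_of_tendsto_of_le_of_le' tendsto_const_nhds h3 ?_ ?_
    · filter_upwards [eventually_ge_atTop 0] with R hR
      positivity
    · filter_upwards [eventually_gt_atTop 0] with R hR
      have : (1 + (δ * R) ^ 2)⁻¹ ≤ ((δ * R) ^ 2)⁻¹ := by
        gcongr
        linarith
      calc R * (1 + (δ * R) ^ 2)⁻¹ ≤ R * ((δ * R) ^ 2)⁻¹ := by gcongr
        _ = _ := by field_simp
  refine squeeze_zero_norm' (a := fun R : ℝ => 2 * (M * (R * Real.exp (-(t - A) * R))) +
    2 * (M * (R * (1 + (δ * R) ^ 2)⁻¹))) ?_ ?_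
  · filter_upwards [eventually_ge_atTop 0] with R hR
    exact hbound R hR
  · simpa using ((hR1.const_mul M).const_mul 2).add ((hR2.const_mul M).const_mul 2)

end ContourShift

/-! ### Pairing the L² transform with Schwartz functions -/

section Pairing

/-- The smooth compactly supported function `u`, modulated to `ξ ↦ u ξ e^{2πisξ}`. -/
noncomputable def modulatedBump {u : ℝ → ℝ} (hu : ContDiff ℝ ∞ u) (hc : HasCompactSupport u)
    (s : ℝ) : 𝓢(ℝ, ℂ) :=
  HasCompactSupport.toSchwartzMap
    (f := fun ξ : ℝ => (u ξ : ℂ) * Complex.exp (2 * Real.pi * Complex.I * s * ξ))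
    ((hc.comp_left (g := ((↑) : ℝ → ℂ)) Complex.ofReal_zero).mul_right)
    ((Complex.ofRealCLM.contDiff.comp hu).mul
      (contDiff_const.mul Complex.ofRealCLM.contDiff).cexp)

theorem modulatedBump_apply {u : ℝ → ℝ} (hu : ContDiff ℝ ∞ u) (hc : HasCompactSupport u)
    (s ξ : ℝ) :
    modulatedBump hu hc s ξ = (u ξ : ℂ) * Complex.exp (2 * Real.pi * Complex.I * s * ξ) := rfl

/-- Modulation becomes translation: shifting the argument of g in a pairing amounts to a unimodular
factor on the frequency side. -/
theorem fourier_modulatedBump {u : ℝ → ℝ} (hu : ContDiff ℝ ∞ u) (hc : HasCompactSupport u)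
    (s x : ℝ) :
    𝓕 (modulatedBump hu hc s) x = 𝓕 (modulatedBump hu hc 0) (x - s) := by
  rw [SchwartzMap.fourier_coe, SchwartzMap.fourier_coe, Real.fourier_real_eq_integral_exp_smul,
    Real.fourier_real_eq_integral_exp_smul]
  congr 1
  ext1 ξ
  simp only [modulatedBump_apply, smul_eq_mul]
  rw [mul_left_comm (Complex.exp _), mul_left_comm (Complex.exp _), ← Complex.exp_add, ← Complex.exp_add]
  congr 2
  push_cast
  ring

theorem integral_mul_fourier_toLp {h : ℝ → ℂ} (hh : MemLp h 2 volume) (w : 𝓢(ℝ, ℂ)) :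
    ∫ x, w x * (𝓕 (hh.toLp h) : Lp ℂ 2 (volume : Measure ℝ)) x = ∫ x, 𝓕 w x * h x := by
  have e1 := congrArg (fun T => T w) (Lp.fourier_toTemperedDistribution_eq (hh.toLp h))
  simp only [TemperedDistribution.fourier_apply, Lp.toTemperedDistribution_apply] at e1
  refine e1.symm.trans (integral_congr_ae ?_)
  filter_upwards [hh.coeFn_toLp] with x hx
  rw [hx, smul_eq_mul]

theorem integral_fourierInv_mul_fourier_toLp {h : ℝ → ℂ} (hh : MemLp h 2 volume) (w : 𝓢(ℝ, ℂ)) :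
    ∫ x, 𝓕⁻ w x * (𝓕 (hh.toLp h) : Lp ℂ 2 (volume : Measure ℝ)) x = ∫ x, w x * h x := by
  rw [integral_mul_fourier_toLp hh, FourierTransform.fourier_fourierInv_eq]

end Pairing

/-! ### Exponential type forces the transform to vanish outside the band -/

section Vanishing

variable {g : ℂ → ℂ} {A C M : ℝ}

/-- After regularisation g is integrable on ℝ, so the Fourier transform can be moved off `w`. At
each ξ either `w` vanishes or the contour shift applies. The limit δ → 0 is dominated by M|𝓕w|. -/
theorem integral_mul_fourier_eq_zero_of_bounded_on_real (hg : Differentiable ℂ g) (hA : 0 ≤ A)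
    (hgC : ∀ z, ‖g z‖ ≤ C * Real.exp (A * ‖z‖)) (hM : ∀ x : ℝ, ‖g x‖ ≤ M) (w : 𝓢(ℝ, ℂ))
    (hw : ∀ ξ, 2 * Real.pi * ξ ≤ A → w ξ = 0) : ∫ x : ℝ, g x * 𝓕 w x = 0 := by
  have hM0 : 0 ≤ M := (norm_nonneg _).trans (hM 0)
  have hgr : Continuous fun x : ℝ => g x := hg.continuous.comp Complex.continuous_ofReal
  set k : ℝ → ℝ → ℂ := fun δ x => ((1 + Complex.I * δ * x) ^ 2)⁻¹ with hk
  have hden : ∀ δ : ℝ, 0 ≤ δ → ∀ x : ℝ, 1 + (δ * x) ^ 2 ≤ ‖1 + Complex.I * δ * x‖ ^ 2 :=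
    fun δ hδ x => by simpa using one_add_sq_le_norm_sq hδ (z := x) (by simp)
  have hkb : ∀ δ : ℝ, 0 ≤ δ → ∀ x : ℝ, ‖k δ x‖ ≤ (1 + (δ * x) ^ 2)⁻¹ := by
    intro δ hδ x
    simp only [hk, norm_inv, norm_pow]
    have : 0 < 1 + (δ * x) ^ 2 := by positivity
    gcongr
    exact hden δ hδ x
  have hkc : ∀ δ : ℝ, 0 ≤ δ → Continuous (k δ) := by
    intro δ hδ
    refine Continuous.inv₀ (by fun_prop) fun x hx => ?_
    have := hden δ hδ x
    rw [← norm_pow, hx, norm_zero] at this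
    nlinarith [sq_nonneg (δ * x)]
  have hzero : ∀ δ : ℝ, 0 < δ → ∫ x : ℝ, (g x * k δ x) * 𝓕 w x = 0 := by
    intro δ hδ
    have hint : Integrable (fun x : ℝ => g x * k δ x) volume := by
      refine (integrable_inv_one_add_mul_sq hδ M).mono'
        (hgr.mul (hkc δ hδ.le)).aestronglyMeasurable (.of_forall fun x => ?_)
      rw [norm_mul]
      exact mul_le_mul (hM x) (hkb δ hδ.le x) (norm_nonneg _) hM0
    have hflip := VectorFourier.integral_fourierIntegral_smul_eq_flip (L := innerₗ ℝ)
      Real.continuous_fourierChar continuous_inner (w.integrable (μ := volume)) hint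
    rw [flip_innerₗ] at hflip
    have hflip' : ∫ x, 𝓕 (w : ℝ → ℂ) x * (g x * k δ x)
        = ∫ ξ, w ξ * 𝓕 (fun x : ℝ => g x * k δ x) ξ := hflip
    simp only [SchwartzMap.fourier_coe]
    rw [integral_congr_ae (.of_forall fun x => mul_comm _ _), hflip']
    refine integral_eq_zero_of_ae (.of_forall fun ξ => ?_)
    rcases le_or_gt (2 * Real.pi * ξ) A with h | h
    · simp [hw ξ h]
    · have hz := integral_mul_inv_sq_mul_exp_eq_zero hg hM0
        (fun z hz => norm_le_of_bounded_on_real_of_exponential_type hg hA hgC hM hz) hδ h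
      have : 𝓕 (fun x : ℝ => g x * k δ x) ξ = 0 := by
        rw [Real.fourier_real_eq_integral_exp_smul, ← hz]
        congr 1
        ext1 x
        rw [smul_eq_mul, mul_comm]
        congr 2
        push_cast
        ring
      simp [this]
  have hlim : Tendsto (fun n : ℕ => ∫ x : ℝ, (g x * k ((n : ℝ) + 1)⁻¹ x) * 𝓕 w x) atTop
      (𝓝 (∫ x : ℝ, g x * 𝓕 w x)) := by
    have hδ : ∀ n : ℕ, (0 : ℝ) ≤ ((n : ℝ) + 1)⁻¹ := fun n => by positivity
    refine tendsto_integral_of_dominated_convergence (fun x => M * ‖𝓕 w x‖) (fun n => ?_)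
      (((𝓕 w).integrable (μ := volume)).norm.const_mul M) (fun n => .of_forall fun x => ?_)
      (.of_forall fun x => ?_)
    · exact ((hgr.mul (hkc _ (hδ n))).mul (𝓕 w).continuous).aestronglyMeasurable
    · rw [norm_mul, norm_mul]
      have h1 : ‖k ((n : ℝ) + 1)⁻¹ x‖ ≤ 1 := (hkb _ (hδ n) x).trans
        (inv_le_one_of_one_le₀ (by nlinarith [sq_nonneg (((n : ℝ) + 1)⁻¹ * x)]))
      gcongr
      calc ‖g x‖ * ‖k ((n : ℝ) + 1)⁻¹ x‖ ≤ M * 1 := by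
            gcongr
            exact hM x
        _ = M := mul_one M
    · have h0 : Tendsto (fun n : ℕ => ((n : ℝ) + 1)⁻¹) atTop (𝓝 0) := by
        simpa using tendsto_one_div_add_atTop_nhds_zero_nat (𝕜 := ℝ)
      have h1 : Tendsto (fun δ : ℝ => k δ x) (𝓝 0) (𝓝 1) := by
        refine (ContinuousAt.tendsto (x := (0 : ℝ)) ?_).trans_eq (by simp [hk])
        refine ContinuousAt.inv₀ (by fun_prop) (by simp)
      have h2 := ((h1.comp h0).const_mul (g x)).mul_const (𝓕 w x)
      simpa using h2
  refine tendsto_nhds_unique hlim (tendsto_const_nhds.congr fun n => (hzero _ (by positivity)).symm)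

/-- Bounding the product by |g|² + |v|² makes the inner integral bounded independently of the shift,
which justifies Fubini. -/
theorem integrable_slide_prod (hg : Continuous g) (hL : MemLp (fun x : ℝ => g x) 2 volume)
    (v : 𝓢(ℝ, ℂ)) (h : ℝ) :
    Integrable (fun p : ℝ × ℝ => g (p.1 + p.2 : ℝ) * v p.1)
      ((volume : Measure ℝ).prod (volume.restrict (Set.Ioc 0 h))) := by
  have hv : Integrable (fun x : ℝ => ‖v x‖ ^ 2) volume :=
    (v.memLp 2).integrable_norm_pow two_ne_zero
  have hsq : Integrable (fun x : ℝ => ‖g x‖ ^ 2) volume := hL.integrable_norm_pow two_ne_zero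
  have hsq' : ∀ s : ℝ, Integrable (fun x : ℝ => ‖g (x + s : ℝ)‖ ^ 2) volume :=
    fun s => hsq.comp_add_right s
  have hcont : Continuous fun p : ℝ × ℝ => g (p.1 + p.2 : ℝ) * v p.1 :=
    (hg.comp (by fun_prop)).mul (v.continuous.comp continuous_fst)
  have hle : ∀ s x : ℝ, ‖g (x + s : ℝ) * v x‖ ≤ ‖g (x + s : ℝ)‖ ^ 2 + ‖v x‖ ^ 2 := by
    intro s x
    rw [norm_mul]
    nlinarith [sq_nonneg (‖g (x + s : ℝ)‖ - ‖v x‖), sq_nonneg (‖g (x + s : ℝ)‖ + ‖v x‖)]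
  have hint : ∀ s : ℝ, Integrable (fun x : ℝ => g (x + s : ℝ) * v x) volume := fun s =>
    ((hsq' s).add hv).mono' ((hcont.comp (by fun_prop : Continuous fun x : ℝ =>
      (x, s))).aestronglyMeasurable) (.of_forall (hle s))
  rw [integrable_prod_iff' hcont.aestronglyMeasurable]
  refine ⟨.of_forall hint, ?_⟩
  refine Integrable.mono' (integrable_const ((∫ x : ℝ, ‖g x‖ ^ 2) + ∫ x, ‖v x‖ ^ 2))
    hcont.norm.aestronglyMeasurable.prod_swap.integral_prod_right' (.of_forall fun s => ?_)
  rw [Real.norm_of_nonneg (integral_nonneg fun _ => norm_nonneg _)]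
  calc _ ≤ ∫ x : ℝ, (‖g (x + s : ℝ)‖ ^ 2 + ‖v x‖ ^ 2) :=
        integral_mono (hint s).norm ((hsq' s).add hv) (hle s)
    _ = _ := by
        rw [integral_add (hsq' s) hv, integral_add_right_eq_self (fun x : ℝ => ‖g x‖ ^ 2)]

/-- Let P(s) be the pairing with g translated by s. By Fubini ∫₀ʰ P is the pairing with a sliding
average, hence 0 by the bounded case. Since P is continuous, P(0) = 0. -/
theorem integral_mul_fourier_modulatedBump_eq_zero (hg : Differentiable ℂ g) (hA : 0 ≤ A)
    (hC : 0 ≤ C) (hgC : ∀ z, ‖g z‖ ≤ C * Real.exp (A * ‖z‖))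
    (hL : MemLp (fun x : ℝ => g x) 2 volume)
    {u : ℝ → ℝ} (hu : ContDiff ℝ ∞ u) (hc : HasCompactSupport u)
    (hsupp : ∀ ξ, 2 * Real.pi * ξ ≤ A → u ξ = 0) :
    ∫ x : ℝ, g x * 𝓕 (modulatedBump hu hc 0) x = 0 := by
  set v := 𝓕 (modulatedBump hu hc 0) with hv
  set P : ℝ → ℂ := fun s => ∫ x : ℝ, g (x + s : ℝ) * v x with hP
  obtain ⟨G, hG, hGp⟩ : ∃ G : ℝ → ℂ, MemLp G 2 volume ∧
      ∀ w : 𝓢(ℝ, ℂ), ∫ ξ, w ξ * G ξ = ∫ x : ℝ, 𝓕 w x * g x :=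
    ⟨_, Lp.memLp _, integral_mul_fourier_toLp hL⟩
  have hPeq : P = fun s => ∫ ξ, (modulatedBump hu hc s) ξ * G ξ := by
    ext1 s
    rw [hGp, ← integral_add_right_eq_self _ s]
    refine integral_congr_ae (.of_forall fun x => ?_)
    simp only
    rw [fourier_modulatedBump hu hc s, add_sub_cancel_right, mul_comm]
  have hPc : Continuous P := by
    rw [hPeq]
    have hint : Integrable (fun ξ => modulatedBump hu hc 0 ξ * G ξ) volume :=
      MemLp.integrable_mul ((modulatedBump hu hc 0).memLp 2 volume) hG
    refine continuous_of_dominated (fun s => ?_) (fun s => .of_forall fun ξ => ?_)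
      hint.norm (.of_forall fun ξ => ?_)
    · exact (modulatedBump hu hc s).continuous.aestronglyMeasurable.mul hG.1
    · simp only [norm_mul, modulatedBump_apply, Complex.norm_exp]
      simp
    · simp only [modulatedBump_apply]
      fun_prop
  have hzero : ∀ h : ℝ, 0 ≤ h → ∫ s in (0)..h, P s = 0 := by
    intro h hh
    rw [intervalIntegral.integral_of_le hh]
    have hswap := integral_integral_swap (f := fun x s : ℝ => g (x + s : ℝ) * v x)
      (integrable_slide_prod hg.continuous hL v h)
    rw [hP, ← hswap, ← integral_mul_fourier_eq_zero_of_bounded_on_real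
      (differentiable_slidingIntegral hg hA hC hgC h) hA (norm_slidingIntegral_le hA hC hgC hh)
      (norm_slidingIntegral_ofReal_le hL hh) (modulatedBump hu hc 0)
      (fun ξ hξ => by simp [modulatedBump_apply, hsupp ξ hξ])]
    refine integral_congr_ae (.of_forall fun x => ?_)
    simp only [integral_mul_const, slidingIntegral, Complex.ofReal_add, hv]
  -- The integral is known to vanish only for h ≥ 0, so derivatives are compared within the
  -- half-line.
  have hderiv := (hPc.integral_hasStrictDerivAt 0 0).hasDerivAt.hasDerivWithinAt (s := Set.Ici 0)
  have hconst : HasDerivWithinAt (fun h : ℝ => ∫ s in (0)..h, P s) 0 (Set.Ici 0) 0 :=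
    (hasDerivWithinAt_const (0 : ℝ) (Set.Ici 0) (0 : ℂ)).congr (fun h hh => hzero h hh) (by simp)
  have := (uniqueDiffWithinAt_Ici (0 : ℝ)).eq_deriv _ hderiv hconst
  simpa [hP] using this

theorem fourier_toLp_ae_eq_zero (hg : Differentiable ℂ g) (hA : 0 ≤ A)
    (hC : 0 ≤ C) (hgC : ∀ z, ‖g z‖ ≤ C * Real.exp (A * ‖z‖))
    (hL : MemLp (fun x : ℝ => g x) 2 volume) :
    ∀ᵐ ξ ∂(volume : Measure ℝ), A < 2 * Real.pi * |ξ| →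
      (𝓕 (hL.toLp _) : Lp ℂ 2 (volume : Measure ℝ)) ξ = 0 := by
  have hloc : LocallyIntegrable (𝓕 (hL.toLp _) : Lp ℂ 2 (volume : Measure ℝ)) volume :=
    (Lp.memLp _).locallyIntegrable (by norm_num)
  have hpair : ∀ {u : ℝ → ℝ} (hu : ContDiff ℝ ∞ u) (hc : HasCompactSupport u),
      ∫ ξ, u ξ • (𝓕 (hL.toLp _) : Lp ℂ 2 (volume : Measure ℝ)) ξ
        = ∫ x : ℝ, g x * 𝓕 (modulatedBump hu hc 0) x := by
    intro u hu hc
    rw [integral_congr_ae (.of_forall fun x => mul_comm _ _), ← integral_mul_fourier_toLp hL]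
    simp [modulatedBump_apply]
  have hpos : ∀ᵐ ξ ∂(volume : Measure ℝ), ξ ∈ {ξ : ℝ | A < 2 * Real.pi * ξ} →
      (𝓕 (hL.toLp _) : Lp ℂ 2 (volume : Measure ℝ)) ξ = 0 := by
    refine (isOpen_lt (by fun_prop) (by fun_prop)).ae_eq_zero_of_integral_contDiff_smul_eq_zero
      (hloc.locallyIntegrableOn _) fun u hu hc hs => ?_
    rw [hpair hu hc]
    refine integral_mul_fourier_modulatedBump_eq_zero hg hA hC hgC hL hu hc fun ξ hξ => ?_
    by_contra h0
    exact absurd (hs (subset_tsupport u h0)) (not_lt.2 hξ)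
  -- Reflection z ↦ -z preserves both the growth bound and square integrability, and exchanges the
  -- two frequency tails.
  have hneg : ∀ᵐ ξ ∂(volume : Measure ℝ), ξ ∈ {ξ : ℝ | A < 2 * Real.pi * (-ξ)} →
      (𝓕 (hL.toLp _) : Lp ℂ 2 (volume : Measure ℝ)) ξ = 0 := by
    refine (isOpen_lt (by fun_prop) (by fun_prop)).ae_eq_zero_of_integral_contDiff_smul_eq_zero
      (hloc.locallyIntegrableOn _) fun u hu hc hs => ?_
    rw [hpair hu hc]
    have hu' : ContDiff ℝ ∞ fun ξ => u (-ξ) := hu.comp contDiff_neg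
    have hc' : HasCompactSupport fun ξ => u (-ξ) := hc.comp_homeomorph (Homeomorph.neg ℝ)
    have hL' : MemLp (fun x : ℝ => g (-(x : ℂ))) 2 volume := by
      have := hL.comp_measurePreserving (Measure.measurePreserving_neg (volume : Measure ℝ))
      simpa [Function.comp_def] using this
    have := integral_mul_fourier_modulatedBump_eq_zero (g := fun z => g (-z))
      (hg.comp differentiable_neg) hA hC (fun z => by simpa using hgC (-z)) hL' hu' hc'
      fun ξ hξ => ?_
    · rw [← this, ← integral_neg_eq_self]
      refine integral_congr_ae (.of_forall fun x => ?_)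
      simp only [Complex.ofReal_neg, SchwartzMap.fourier_coe]
      congr 1
      rw [Real.fourier_real_eq_integral_exp_smul, Real.fourier_real_eq_integral_exp_smul,
        ← integral_neg_eq_self]
      refine integral_congr_ae (.of_forall fun ξ => ?_)
      simp [modulatedBump_apply]
    · by_contra h0
      exact absurd (hs (subset_tsupport u h0)) (by simpa using hξ)
  filter_upwards [hpos, hneg] with ξ h1 h2 h
  rcases abs_cases ξ with ⟨e, _⟩ | ⟨e, _⟩
  · exact h1 (by simpa [e] using h)
  · exact h2 (by simpa [e] using h)

end Vanishing

/-! ### Band-limited functions: inversion and growth -/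

section Inversion

variable {A : ℝ}

theorem norm_exp_two_pi_mul_le {ξ : ℝ} (hξ : 2 * Real.pi * |ξ| ≤ A) (z : ℂ) :
    ‖Complex.exp (2 * Real.pi * Complex.I * z * ξ)‖ ≤ Real.exp (A * |z.im|) := by
  rw [Complex.norm_exp, Real.exp_le_exp]
  have e : (2 * Real.pi * Complex.I * z * ξ : ℂ).re = -(2 * Real.pi * ξ) * z.im := by
    simp; ring
  rw [e]
  refine (le_abs_self _).trans ?_
  rw [abs_mul, abs_neg, abs_mul, abs_of_pos (by positivity : (0 : ℝ) < 2 * Real.pi)]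
  gcongr

/-- The frequency band `{ξ | 2π|ξ| ≤ A}`. -/
def frequencyBand (A : ℝ) : Set ℝ := Set.Icc (-(A / (2 * Real.pi))) (A / (2 * Real.pi))

theorem mem_frequencyBand {ξ : ℝ} : ξ ∈ frequencyBand A ↔ 2 * Real.pi * |ξ| ≤ A := by
  rw [frequencyBand, Set.mem_Icc, ← abs_le, le_div_iff₀ (by positivity), mul_comm]

theorem integral_eq_setIntegral_frequencyBand {G : ℝ → ℂ}
    (hz : ∀ᵐ ξ ∂(volume : Measure ℝ), A < 2 * Real.pi * |ξ| → G ξ = 0) (k : ℝ → ℂ) :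
    ∫ ξ in frequencyBand A, k ξ * G ξ = ∫ ξ, k ξ * G ξ := by
  refine setIntegral_eq_integral_of_ae_compl_eq_zero ?_
  filter_upwards [hz] with ξ h hξ
  rw [mem_frequencyBand, not_le] at hξ
  rw [h hξ, mul_zero]

theorem integrable_restrict_frequencyBand {G : ℝ → ℂ} (hG : MemLp G 2 volume) :
    Integrable G (volume.restrict (frequencyBand A)) :=
  haveI : IsFiniteMeasure ((volume : Measure ℝ).restrict (frequencyBand A)) :=
    inferInstanceAs (IsFiniteMeasure ((volume : Measure ℝ).restrict (Set.Icc _ _)))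
  ((hG.restrict _).mono_exponent (by norm_num)).integrable le_rfl

/-- The kernel is at most e^{A|Im z|} on the band, and Cauchy–Schwarz on the band, of length A/π,
bounds the L¹ norm of G by its L² norm. -/
theorem norm_integral_exp_mul_le {G : ℝ → ℂ} (hG : MemLp G 2 volume)
    (hz : ∀ᵐ ξ ∂(volume : Measure ℝ), A < 2 * Real.pi * |ξ| → G ξ = 0) (z : ℂ) :
    ‖∫ ξ : ℝ, Complex.exp (2 * Real.pi * Complex.I * z * ξ) * G ξ‖ ≤ Real.exp (A * |z.im|) *
      (eLpNorm G 2 volume * ENNReal.ofReal (A / Real.pi) ^ (1 / 2 : ℝ)).toReal := by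
  have hint := integrable_restrict_frequencyBand (A := A) hG
  rw [← integral_eq_setIntegral_frequencyBand hz]
  calc _ ≤ ∫ ξ in frequencyBand A, Real.exp (A * |z.im|) * ‖G ξ‖ := by
        refine norm_integral_le_of_norm_le (hint.norm.const_mul _) ?_
        filter_upwards [ae_restrict_mem measurableSet_Icc] with ξ hξ
        rw [norm_mul]
        gcongr
        exact norm_exp_two_pi_mul_le (mem_frequencyBand.1 hξ) z
    _ = Real.exp (A * |z.im|) * (eLpNorm G 1 (volume.restrict (frequencyBand A))).toReal := by
        rw [integral_const_mul, integral_norm_eq_lintegral_enorm hint.1,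
          eLpNorm_one_eq_lintegral_enorm]
    _ ≤ _ := by
        gcongr
        · exact ENNReal.mul_ne_top hG.2.ne
            (ENNReal.rpow_ne_top_of_nonneg (by norm_num) ENNReal.ofReal_ne_top)
        refine (eLpNorm_le_eLpNorm_mul_rpow_measure_univ (by norm_num : (1 : ENNReal) ≤ 2)
          hint.1).trans ?_
        refine mul_le_mul' (eLpNorm_mono_measure _ Measure.restrict_le_self) (le_of_eq ?_)
        rw [Measure.restrict_apply_univ, frequencyBand, Real.volume_Icc]
        congr 1
        · congr 1
          field_simp
          norm_num
        · norm_num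

theorem integrable_exp_mul {G : ℝ → ℂ} (hG : MemLp G 2 volume)
    (hz : ∀ᵐ ξ ∂(volume : Measure ℝ), A < 2 * Real.pi * |ξ| → G ξ = 0) (z : ℂ) :
    Integrable (fun ξ : ℝ => Complex.exp (2 * Real.pi * Complex.I * z * ξ) * G ξ) volume := by
  have h : IntegrableOn (fun ξ : ℝ => Complex.exp (2 * Real.pi * Complex.I * z * ξ) * G ξ)
      (frequencyBand A) volume := by
    have hint := integrable_restrict_frequencyBand (A := A) hG
    refine hint.bdd_mul (c := Real.exp (A * |z.im|)) (by fun_prop) ?_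
    filter_upwards [ae_restrict_mem measurableSet_Icc] with ξ hξ
    exact norm_exp_two_pi_mul_le (mem_frequencyBand.1 hξ) z
  refine ((integrable_indicator_iff measurableSet_Icc).2 h).congr ?_
  filter_upwards [hz] with ξ hξ
  by_cases hm : ξ ∈ frequencyBand A
  · exact Set.indicator_of_mem hm _
  · refine (Set.indicator_of_notMem hm _).trans ?_
    rw [mem_frequencyBand, not_le] at hm
    rw [hξ hm, mul_zero]

theorem differentiable_integral_exp_mul {G : ℝ → ℂ} (hG : MemLp G 2 volume)
    (hz : ∀ᵐ ξ ∂(volume : Measure ℝ), A < 2 * Real.pi * |ξ| → G ξ = 0) :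
    Differentiable ℂ fun z => ∫ ξ : ℝ, Complex.exp (2 * Real.pi * Complex.I * z * ξ) * G ξ := by
  have hint := integrable_restrict_frequencyBand (A := A) hG
  simp only [← integral_eq_setIntegral_frequencyBand hz]
  refine differentiable_integral_of_differentiable (fun z => ?_) (fun ξ => by fun_prop)
    (fun R ξ => Real.exp (|A| * R) * ‖G ξ‖) (fun R => hint.norm.const_mul _) (fun R => ?_)
  · exact (by fun_prop : Continuous fun ξ : ℝ =>
      Complex.exp (2 * Real.pi * Complex.I * z * ξ)).aestronglyMeasurable.mul hint.1
  · filter_upwards [ae_restrict_mem measurableSet_Icc] with ξ hξ z hzR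
    rw [norm_mul]
    refine mul_le_mul_of_nonneg_right ((norm_exp_two_pi_mul_le (mem_frequencyBand.1 hξ) z).trans ?_)
      (norm_nonneg _)
    have := (Complex.abs_im_le_norm z).trans hzR
    rw [Real.exp_le_exp]
    exact mul_le_mul (le_abs_self _) this (abs_nonneg _) (abs_nonneg _)

/-- Both sides are entire. On ℝ they have the same integrals against test functions, so they agree
a.e. and, by continuity, everywhere on ℝ; the identity theorem extends this to ℂ. -/
theorem eq_integral_exp_mul_fourier {g : ℂ → ℂ} (hg : Differentiable ℂ g)
    (hL : MemLp (fun x : ℝ => g x) 2 volume)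
    (hz : ∀ᵐ ξ ∂(volume : Measure ℝ), A < 2 * Real.pi * |ξ| →
      (𝓕 (hL.toLp _) : Lp ℂ 2 (volume : Measure ℝ)) ξ = 0) (z : ℂ) :
    g z = ∫ ξ : ℝ, Complex.exp (2 * Real.pi * Complex.I * z * ξ) *
      (𝓕 (hL.toLp _) : Lp ℂ 2 (volume : Measure ℝ)) ξ := by
  obtain ⟨G, hGeq, hG, hGp⟩ : ∃ G : ℝ → ℂ,
      G = (𝓕 (hL.toLp _) : Lp ℂ 2 (volume : Measure ℝ)) ∧ MemLp G 2 volume ∧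
      ∀ w : 𝓢(ℝ, ℂ), ∫ ξ, 𝓕⁻ w ξ * G ξ = ∫ x : ℝ, w x * g x :=
    ⟨_, rfl, Lp.memLp _, integral_fourierInv_mul_fourier_toLp hL⟩
  rw [← hGeq] at hz ⊢
  have hint : Integrable G volume := by simpa using integrable_exp_mul hG hz 0
  set E : ℂ → ℂ := fun z => ∫ ξ : ℝ, Complex.exp (2 * Real.pi * Complex.I * z * ξ) * G ξ with hE
  have hEd : Differentiable ℂ E := differentiable_integral_exp_mul hG hz
  have hEinv : ∀ x : ℝ, 𝓕⁻ G x = E x := by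
    intro x
    rw [Real.fourierInv_eq_fourier_neg, Real.fourier_real_eq_integral_exp_smul]
    refine integral_congr_ae (.of_forall fun ξ => ?_)
    simp only [smul_eq_mul]
    congr 2
    push_cast
    ring
  have hgc : Continuous fun x : ℝ => g x := hg.continuous.comp Complex.continuous_ofReal
  have hEc : Continuous fun x : ℝ => E x := hEd.continuous.comp Complex.continuous_ofReal
  have hae : (fun x : ℝ => g x) =ᵐ[volume] fun x : ℝ => E x := by
    refine ae_eq_of_integral_contDiff_smul_eq hgc.locallyIntegrable hEc.locallyIntegrable
      fun u hu hc => ?_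
    set w := modulatedBump hu hc 0 with hw
    have hwu : ∀ x, w x = (u x : ℂ) := fun x => by simp [hw, modulatedBump_apply]
    -- Negating the inner product yields the multiplication formula for 𝓕⁻ instead of 𝓕.
    have hflip := VectorFourier.integral_fourierIntegral_smul_eq_flip (L := -innerₗ ℝ)
      Real.continuous_fourierChar (by exact (continuous_inner (𝕜 := ℝ)).neg)
      (w.integrable (μ := volume)) hint
    have hflip' : ∫ ξ, 𝓕⁻ (w : ℝ → ℂ) ξ * G ξ = ∫ x, w x * 𝓕⁻ G x := by
      have : (-innerₗ ℝ : ℝ →ₗ[ℝ] ℝ →ₗ[ℝ] ℝ).flip = -innerₗ ℝ := by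
        ext
        simp
      rw [this] at hflip
      exact hflip
    have h1 := hGp w
    rw [SchwartzMap.fourierInv_coe, hflip'] at h1
    simpa [hwu, hEinv] using h1.symm
  have hreal : (fun x : ℝ => g x) = fun x : ℝ => E x := hgc.ae_eq_iff_eq volume hEc |>.1 hae
  have hev : ∃ᶠ w in 𝓝[≠] (0 : ℂ), g w = E w := by
    have hlim : Tendsto (fun x : ℝ => (x : ℂ)) (𝓝[≠] 0) (𝓝[≠] 0) := by
      refine tendsto_nhdsWithin_iff.2 ⟨?_, ?_⟩
      · exact (Complex.continuous_ofReal.tendsto' 0 0 (by simp)).mono_left nhdsWithin_le_nhds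
      · filter_upwards [self_mem_nhdsWithin] with x hx
        simpa using hx
    exact hlim.frequently (.of_forall fun x => congrFun hreal x)
  exact congrFun (AnalyticOnNhd.eq_of_frequently_eq
    (hg.differentiableOn.analyticOnNhd isOpen_univ)
    (hEd.differentiableOn.analyticOnNhd isOpen_univ) hev) z

theorem eLpNorm_fourier_toLp {h : ℝ → ℂ} (hh : MemLp h 2 volume) :
    eLpNorm (𝓕 (hh.toLp h) : Lp ℂ 2 (volume : Measure ℝ)) 2 volume = eLpNorm h 2 volume := by
  rw [← Lp.enorm_def, ← Lp.enorm_toLp (hf := hh)]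
  exact congrArg ENNReal.ofNNReal (Subtype.ext (Lp.norm_fourier_eq _))

end Inversion

/-! ### Slices and the splitting ℍ = ℂ_I ⊕ ℂ_I J -/

section Slices

variable {I : ℍ}

/-- The embedding `x + iy ↦ x + Iy` of `ℂ` onto the slice `ℂ_I`. -/
noncomputable def sliceEmbedding (hI : I ∈ imagUnitSphere) : ℂ →ₐ[ℝ] ℍ :=
  Complex.lift ⟨I, imagUnit_mul_self hI⟩

theorem sliceEmbedding_I (hI : I ∈ imagUnitSphere) : sliceEmbedding hI Complex.I = I := by
  simp [sliceEmbedding]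

theorem sliceEmbedding_apply (hI : I ∈ imagUnitSphere) (z : ℂ) :
    sliceEmbedding hI z = (z.re : ℍ) + I * (z.im : ℍ) := by
  rw [← Quaternion.coe_commutes]
  simp [sliceEmbedding, Complex.liftAux_apply, Quaternion.coe_mul_eq_smul]

theorem sliceEmbedding_ofReal (hI : I ∈ imagUnitSphere) (r : ℝ) :
    sliceEmbedding hI r = (r : ℍ) := by
  simp [sliceEmbedding]

theorem imagUnit_sq_add (hI : I ∈ imagUnitSphere) : I.imI ^ 2 + I.imJ ^ 2 + I.imK ^ 2 = 1 := by
  have h : Quaternion.normSq I = 1 := by rw [Quaternion.normSq_eq_norm_mul_self, hI.2, mul_one]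
  rw [Quaternion.normSq_def', hI.1] at h
  linarith

theorem norm_sliceEmbedding (hI : I ∈ imagUnitSphere) (z : ℂ) : ‖sliceEmbedding hI z‖ = ‖z‖ := by
  have h := imagUnit_sq_add hI
  rw [← sq_eq_sq₀ (norm_nonneg _) (norm_nonneg _), sq, ← Quaternion.normSq_eq_norm_mul_self,
    Complex.sq_norm, Complex.normSq_apply, Quaternion.normSq_def', sliceEmbedding_apply]
  simp only [Quaternion.re_add, Quaternion.re_coe, Quaternion.re_mul, hI.1, Quaternion.imI_add,
    Quaternion.imI_coe, Quaternion.imI_mul, Quaternion.imJ_add, Quaternion.imJ_coe,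
    Quaternion.imJ_mul, Quaternion.imK_add, Quaternion.imK_coe, Quaternion.imK_mul]
  linear_combination z.im ^ 2 * h

/-- The slice embedding as a continuous linear map. -/
noncomputable def sliceEmbeddingCLM (hI : I ∈ imagUnitSphere) : ℂ →L[ℝ] ℍ :=
  (sliceEmbedding hI).toLinearMap.toContinuousLinearMap

theorem sliceEmbeddingCLM_apply (hI : I ∈ imagUnitSphere) (z : ℂ) :
    sliceEmbeddingCLM hI z = sliceEmbedding hI z := rfl

theorem sliceEmbedding_exp (hI : I ∈ imagUnitSphere) (z : ℂ) :
    sliceEmbedding hI (Complex.exp z) = NormedSpace.exp (sliceEmbedding hI z) := by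
  let +nondep : NormedAlgebra ℚ ℍ := .restrictScalars ℚ ℝ ℍ
  rw [Complex.exp_eq_exp_ℂ, NormedSpace.map_exp (sliceEmbedding hI) (sliceEmbeddingCLM hI).continuous]

/-- The `ℂ_I`-component of a quaternion, read as a complex number. -/
noncomputable def sliceCoord (I : ℍ) : ℍ →L[ℝ] ℂ :=
  LinearMap.toContinuousLinearMap
    { toFun := fun q => ⟨q.re, -(I * q).re⟩
      map_add' := fun p q => by
        apply Complex.ext
        · simp
        · simp only [mul_add, Quaternion.re_add, Complex.add_im]
          ring
      map_smul' := fun r q => by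
        apply Complex.ext
        · simp
        · simp only [mul_smul_comm, Quaternion.re_smul, smul_eq_mul, RingHom.id_apply,
            Complex.smul_im, mul_neg] }

theorem sliceCoord_re (I q : ℍ) : (sliceCoord I q).re = q.re := rfl

theorem sliceCoord_im (I q : ℍ) : (sliceCoord I q).im = -(I * q).re := rfl

theorem abs_re_le_norm (q : ℍ) : |q.re| ≤ ‖q‖ := by
  refine abs_le_of_sq_le_sq ?_ (norm_nonneg q)
  rw [sq ‖q‖, ← Quaternion.normSq_eq_norm_mul_self, Quaternion.normSq_def']
  nlinarith [sq_nonneg q.imI, sq_nonneg q.imJ, sq_nonneg q.imK]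

theorem norm_sliceCoord_le (hI : I ∈ imagUnitSphere) (q : ℍ) : ‖sliceCoord I q‖ ≤ 2 * ‖q‖ := by
  refine (Complex.norm_le_abs_re_add_abs_im _).trans ?_
  rw [sliceCoord_re, sliceCoord_im, abs_neg]
  have h1 := abs_re_le_norm q
  have h2 := abs_re_le_norm (I * q)
  rw [norm_mul, hI.2, one_mul] at h2
  linarith

theorem sliceCoord_mul (hI : I ∈ imagUnitSphere) (q : ℍ) :
    sliceCoord I (I * q) = Complex.I * sliceCoord I q := by
  apply Complex.ext
  · simp [sliceCoord_re, sliceCoord_im]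
  · simp [sliceCoord_re, sliceCoord_im, ← mul_assoc, imagUnit_mul_self hI]

theorem sliceCoord_sliceEmbedding (hI : I ∈ imagUnitSphere) (z : ℂ) :
    sliceCoord I (sliceEmbedding hI z) = z := by
  apply Complex.ext
  · simp [sliceCoord_re, sliceEmbedding_apply, hI.1]
  · rw [sliceCoord_im, sliceEmbedding_apply, mul_add, ← mul_assoc, imagUnit_mul_self hI]
    simp [hI.1]

/-- ℂ_I J is orthogonal to ℂ_I, so the two summands of the splitting can be separated. -/
theorem sliceCoord_sliceEmbedding_mul {J : ℍ} (hI : I ∈ imagUnitSphere) (hJ : J.re = 0)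
    (hIJ : (I * J).re = 0) (z : ℂ) : sliceCoord I (sliceEmbedding hI z * J) = 0 := by
  have e : ∀ r : ℝ, I * (r : ℍ) = r • I := fun r => by
    rw [← Quaternion.coe_commutes, Quaternion.coe_mul_eq_smul]
  apply Complex.ext
  · rw [sliceCoord_re, sliceEmbedding_apply, add_mul, e, smul_mul_assoc,
      Quaternion.coe_mul_eq_smul]
    simp only [Quaternion.re_add, Quaternion.re_smul, hJ, hIJ]
    simp
  · rw [sliceCoord_im, sliceEmbedding_apply, add_mul, e, smul_mul_assoc,
      Quaternion.coe_mul_eq_smul, mul_add, mul_smul_comm, mul_smul_comm, ← mul_assoc,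
      imagUnit_mul_self hI]
    simp only [Quaternion.re_add, Quaternion.re_smul, hIJ, neg_mul, one_mul, Quaternion.re_neg, hJ]
    simp

theorem mem_imagUnitSphere_of_sq_add {q : ℍ} (h0 : q.re = 0)
    (h1 : q.imI ^ 2 + q.imJ ^ 2 + q.imK ^ 2 = 1) : q ∈ imagUnitSphere := by
  refine ⟨h0, ?_⟩
  rw [← sq_eq_sq₀ (norm_nonneg _) zero_le_one, sq, ← Quaternion.normSq_eq_norm_mul_self,
    Quaternion.normSq_def', h0]
  linarith

/-- Rotating the (j, k)-part of `I` by a right angle and normalising gives `J`; if that part is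
zero, j itself works. -/
theorem exists_orthogonal_imagUnit (hI : I ∈ imagUnitSphere) :
    ∃ J ∈ imagUnitSphere, (I * J).re = 0 := by
  have h := imagUnit_sq_add hI
  by_cases hb : I.imJ ^ 2 + I.imK ^ 2 = 0
  · have h2 : I.imJ = 0 := by nlinarith [sq_nonneg I.imJ, sq_nonneg I.imK]
    obtain ⟨J, j0, j1, j2, j3⟩ : ∃ J : ℍ, J.re = 0 ∧ J.imI = 0 ∧ J.imJ = 1 ∧ J.imK = 0 :=
      ⟨⟨0, 0, 1, 0⟩, rfl, rfl, rfl, rfl⟩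
    refine ⟨J, mem_imagUnitSphere_of_sq_add j0 (by rw [j1, j2, j3]; norm_num), ?_⟩
    rw [Quaternion.re_mul, hI.1, h2, j1, j3]
    ring
  · have hpos : 0 < I.imJ ^ 2 + I.imK ^ 2 := lt_of_le_of_ne (by positivity) (Ne.symm hb)
    set r := (Real.sqrt (I.imJ ^ 2 + I.imK ^ 2))⁻¹ with hr
    have hr2 : r ^ 2 * (I.imJ ^ 2 + I.imK ^ 2) = 1 := by
      rw [hr, inv_pow, Real.sq_sqrt hpos.le, inv_mul_cancel₀ hb]
    obtain ⟨J, j0, j1, j2, j3⟩ :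
        ∃ J : ℍ, J.re = 0 ∧ J.imI = 0 ∧ J.imJ = -(r * I.imK) ∧ J.imK = r * I.imJ :=
      ⟨⟨0, 0, -(r * I.imK), r * I.imJ⟩, rfl, rfl, rfl, rfl⟩
    refine ⟨J, mem_imagUnitSphere_of_sq_add j0 (by rw [j1, j2, j3]; linarith), ?_⟩
    rw [Quaternion.re_mul, hI.1, j1, j2, j3]
    ring

/-- The map q ↦ (q - IqI)/2 fixes what commutes with `I` and kills what anticommutes with it: it is
the projection onto ℂ_I. -/
theorem sliceEmbedding_sliceCoord (hI : I ∈ imagUnitSphere) (q : ℍ) :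
    sliceEmbedding hI (sliceCoord I q) = (1 / 2 : ℝ) • (q - I * q * I) := by
  have h := imagUnit_sq_add hI
  rw [sliceEmbedding_apply, sliceCoord_re, sliceCoord_im]
  ext <;> simp only [Quaternion.re_add, Quaternion.imI_add, Quaternion.imJ_add, Quaternion.imK_add,
    Quaternion.re_sub, Quaternion.imI_sub, Quaternion.imJ_sub, Quaternion.imK_sub,
    Quaternion.re_smul, Quaternion.imI_smul, Quaternion.imJ_smul, Quaternion.imK_smul,
    Quaternion.re_mul, Quaternion.imI_mul, Quaternion.imJ_mul, Quaternion.imK_mul,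
    Quaternion.re_coe, Quaternion.imI_coe, Quaternion.imJ_coe, Quaternion.imK_coe, hI.1,
    smul_eq_mul]
  · linear_combination -(q.re / 2) * h
  · linear_combination (q.imI / 2) * h
  · linear_combination (q.imJ / 2) * h
  · linear_combination (q.imK / 2) * h

theorem imagUnit_anticomm {J : ℍ} (hI : I ∈ imagUnitSphere) (hJ : J ∈ imagUnitSphere)
    (hIJ : (I * J).re = 0) : J * I = -(I * J) := by
  have h : I.imI * J.imI + I.imJ * J.imJ + I.imK * J.imK = 0 := by
    rw [Quaternion.re_mul, hI.1] at hIJ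
    linarith
  ext <;> simp only [Quaternion.re_mul, Quaternion.imI_mul, Quaternion.imJ_mul, Quaternion.imK_mul,
    Quaternion.re_neg, Quaternion.imI_neg, Quaternion.imJ_neg, Quaternion.imK_neg, hI.1, hJ.1]
  · linear_combination -2 * h
  all_goals ring

/-- The second coefficient is the ℂ_I-part of q(-J) = qJ⁻¹. Because JIJ = I, multiplying it back by
`J` gives (q + IqI)/2, the complement of the first projection. -/
theorem sliceEmbedding_sliceCoord_add {J : ℍ} (hI : I ∈ imagUnitSphere) (hJ : J ∈ imagUnitSphere)
    (hIJ : (I * J).re = 0) (q : ℍ) :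
    sliceEmbedding hI (sliceCoord I q) + sliceEmbedding hI (sliceCoord I (q * -J)) * J = q := by
  have h1 : I * (q * -J) * I * J = -(I * q * I) := by
    have : J * (I * J) = I := by
      rw [← mul_assoc, imagUnit_anticomm hI hJ hIJ, neg_mul, mul_assoc, imagUnit_mul_self hJ]
      simp
    calc _ = -(I * q * (J * (I * J))) := by noncomm_ring
      _ = _ := by rw [this]
  have h2 : q * -J * J = q := by
    rw [mul_assoc, neg_mul, imagUnit_mul_self hJ]
    simp
  rw [sliceEmbedding_sliceCoord, sliceEmbedding_sliceCoord, smul_mul_assoc, sub_mul, h1, h2,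
    ← smul_add, sub_neg_eq_add, sub_add_add_cancel, ← two_smul ℝ q, smul_smul]
  norm_num

theorem exists_sliceEmbedding_eq (q : ℍ) :
    ∃ (I : ℍ) (hI : I ∈ imagUnitSphere) (z : ℂ), sliceEmbedding hI z = q := by
  have hq : (q.re : ℍ) + q.im = q := Quaternion.re_add_im q
  by_cases h : q.im = 0
  · obtain ⟨I, i0, i1, i2, i3⟩ : ∃ I : ℍ, I.re = 0 ∧ I.imI = 1 ∧ I.imJ = 0 ∧ I.imK = 0 :=
      ⟨⟨0, 1, 0, 0⟩, rfl, rfl, rfl, rfl⟩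
    refine ⟨I, mem_imagUnitSphere_of_sq_add i0 (by rw [i1, i2, i3]; norm_num), q.re, ?_⟩
    rw [sliceEmbedding_ofReal]
    simpa [h] using hq
  · have hn : ‖q.im‖ ≠ 0 := norm_ne_zero_iff.2 h
    have hi : ‖q.im‖⁻¹ • q.im ∈ imagUnitSphere := by
      refine ⟨by simp, ?_⟩
      rw [norm_smul, norm_inv, norm_norm, inv_mul_cancel₀ hn]
    refine ⟨_, hi, ⟨q.re, ‖q.im‖⟩, ?_⟩
    rw [sliceEmbedding_apply, ← Quaternion.coe_commutes, Quaternion.coe_mul_eq_smul, smul_smul,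
      mul_inv_cancel₀ hn, one_smul, hq]

/-- A complex component of the restriction of `f` to the slice `ℂ_I`. -/
noncomputable def sliceComponent (hI : I ∈ imagUnitSphere) (f : ℍ → ℍ) (e : ℍ) (z : ℂ) : ℂ :=
  sliceCoord I (f (sliceEmbedding hI z) * e)

/-- Right multiplication by `e` commutes with left multiplication by `I`, and `sliceCoord` turns the
latter into multiplication by i. The slice equation thus becomes the Cauchy–Riemann equation. -/
theorem LeftSliceRegularOn.differentiable_sliceComponent {f : ℍ → ℍ}
    (hf : LeftSliceRegularOn f Set.univ) (hI : I ∈ imagUnitSphere) (e : ℍ) :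
    Differentiable ℂ (sliceComponent hI f e) := by
  obtain ⟨-, hd, hcr⟩ := hf
  intro z
  have hfd : HasFDerivAt f (fderiv ℝ f (sliceEmbedding hI z)) (sliceEmbedding hI z) :=
    ((hd _ (Set.mem_univ _)).differentiableAt univ_mem).hasFDerivAt
  set D := fderiv ℝ f (sliceEmbedding hI z) with hD
  let T : ℍ →L[ℝ] ℂ := (sliceCoord I).comp ((ContinuousLinearMap.mul ℝ ℍ).flip e)
  have hT : ∀ q, T q = sliceCoord I (q * e) := fun q => rfl
  have hcomp : HasFDerivAt (fun w : ℂ => f (sliceEmbedding hI w)) (D.comp (sliceEmbeddingCLM hI)) z :=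
    HasFDerivAt.comp z (f := sliceEmbeddingCLM hI) hfd (sliceEmbeddingCLM hI).hasFDerivAt
  have hg : HasFDerivAt (sliceComponent hI f e) (T.comp (D.comp (sliceEmbeddingCLM hI))) z :=
    T.hasFDerivAt.comp z hcomp
  rw [differentiableAt_complex_iff_differentiableAt_real]
  refine ⟨hg.differentiableAt, ?_⟩
  have h1 : HasDerivAt (fun s : ℝ => f ((s : ℍ) + I * (z.im : ℍ))) (D 1) z.re := by
    have hl : HasDerivAt (fun s : ℝ => (s : ℂ) + z.im * Complex.I) 1 z.re :=
      (Complex.ofRealCLM.hasDerivAt (x := z.re)).add_const _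
    have h := HasFDerivAt.comp_hasDerivAt (𝕜 := ℝ) (f := fun s : ℝ => (s : ℂ) + z.im * Complex.I)
      z.re (l := fun w : ℂ => f (sliceEmbedding hI w)) (by rwa [Complex.re_add_im]) hl
    simpa [Function.comp_def, sliceEmbedding_apply, sliceEmbeddingCLM_apply] using h
  have h2 : HasDerivAt (fun s : ℝ => f ((z.re : ℍ) + I * (s : ℍ))) (D I) z.im := by
    have hl : HasDerivAt (fun s : ℝ => (z.re : ℂ) + s * Complex.I) Complex.I z.im := by
      simpa using ((Complex.ofRealCLM.hasDerivAt (x := z.im)).mul_const Complex.I).const_add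
        (z.re : ℂ)
    have h := HasFDerivAt.comp_hasDerivAt (𝕜 := ℝ) (f := fun s : ℝ => (z.re : ℂ) + s * Complex.I)
      z.im (l := fun w : ℂ => f (sliceEmbedding hI w)) (by rwa [Complex.re_add_im]) hl
    simpa [Function.comp_def, sliceEmbedding_apply, sliceEmbeddingCLM_apply] using h
  have hcr' := hcr I hI z.re z.im (Set.mem_univ _)
  rw [h1.deriv, h2.deriv, smul_eq_zero_iff_right (by norm_num)] at hcr'
  have h3 : D 1 = -(I * D I) := eq_neg_of_add_eq_zero_left hcr'
  rw [hg.fderiv]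
  simp only [ContinuousLinearMap.comp_apply, sliceEmbeddingCLM_apply, sliceEmbedding_I, map_one]
  rw [h3, hT, hT, neg_mul, map_neg, mul_assoc, sliceCoord_mul hI, smul_eq_mul, mul_neg, ← mul_assoc,
    Complex.I_mul_I]
  simp

end Slices

/-! ### The quaternionic transform in complex components -/

section QuaternionTransform

variable {I J : ℍ} {A : ℝ}

theorem ae_comp_div {p : ℝ → Prop} (h : ∀ᵐ ξ ∂(volume : Measure ℝ), p ξ) {c : ℝ} (hc : c ≠ 0) :
    ∀ᵐ t ∂(volume : Measure ℝ), p (t / c) := by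
  have hq : Measure.QuasiMeasurePreserving (fun t : ℝ => t * c⁻¹) volume volume := by
    refine ⟨by fun_prop, ?_⟩
    rw [Real.map_volume_mul_right (inv_ne_zero hc)]
    exact Measure.smul_absolutelyContinuous
  simpa [div_eq_mul_inv] using hq.ae h

/-- A locally null set is null, which passes from local vanishing near each exterior point to a.e.
vanishing. Conversely {|s| > A} is itself an admissible open set. -/
theorem essentialSupport_subset_Icc_iff {G : ℝ → ℍ} :
    essentialSupport G ⊆ Set.Icc (-A) A ↔
      ∀ᵐ t ∂(volume : Measure ℝ), A < |t| → G t = 0 := by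
  constructor
  · intro h
    refine measure_null_of_locally_null _ fun t ht => ?_
    simp only [Set.mem_compl_iff, Set.mem_ofPred_eq, Classical.not_imp] at ht
    have hnot : t ∉ essentialSupport G := fun hmem => not_le.2 ht.1 (abs_le.2 (h hmem))
    obtain ⟨U, hU, htU, hae⟩ := not_not.1 hnot
    refine ⟨U ∩ {s | ¬ (A < |s| → G s = 0)},
      inter_mem (mem_nhdsWithin_of_mem_nhds (hU.mem_nhds htU)) self_mem_nhdsWithin, ?_⟩
    refine measure_mono_null (fun s hs => ?_) hae
    simp only [Set.mem_inter_iff, Set.mem_ofPred_eq, Classical.not_imp] at hs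
    simp only [Set.mem_compl_iff, Set.mem_ofPred_eq, Classical.not_imp]
    exact ⟨hs.1, hs.2.2⟩
  · intro h t ht
    by_contra hmem
    refine ht ⟨{s | A < |s|}, isOpen_lt continuous_const continuous_abs, ?_, h⟩
    rw [Set.mem_Icc, ← abs_le, not_le] at hmem
    exact hmem

theorem memLp_sliceCoord_mul (I : ℍ) {F : ℝ → ℍ} (hF : MemLp F 2 volume) (e : ℍ) :
    MemLp (fun x => sliceCoord I (F x * e)) 2 volume :=
  ((sliceCoord I).comp ((ContinuousLinearMap.mul ℝ ℍ).flip e)).comp_memLp' hF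

theorem eLpNorm_sliceCoord_mul_le (hI : I ∈ imagUnitSphere) (F : ℝ → ℍ) {e : ℍ} (he : ‖e‖ = 1) :
    eLpNorm (fun x => sliceCoord I (F x * e)) 2 volume ≤ 2 * eLpNorm F 2 volume := by
  have := eLpNorm_le_mul_eLpNorm_of_ae_le_mul (c := 2) (p := 2) (μ := (volume : Measure ℝ))
    (f := fun x => sliceCoord I (F x * e)) (g := F) (.of_forall fun x => by
      simpa [he] using norm_sliceCoord_le hI (F x * e))
  simpa using this

/-- The complex `L²` Fourier transform of the component `x ↦ sliceCoord I (F x * e)`. -/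
noncomputable def componentFourier (I : ℍ) {F : ℝ → ℍ} (hF : MemLp F 2 volume) (e : ℍ) : ℝ → ℂ :=
  (𝓕 ((memLp_sliceCoord_mul I hF e).toLp _) : Lp ℂ 2 (volume : Measure ℝ))

theorem memLp_componentFourier (I : ℍ) {F : ℝ → ℍ} (hF : MemLp F 2 volume) (e : ℍ) :
    MemLp (componentFourier I hF e) 2 volume := Lp.memLp _

/-- The bound does not depend on `I`; this makes the final exponential bound uniform over slices. -/
theorem eLpNorm_componentFourier_le (hI : I ∈ imagUnitSphere) {F : ℝ → ℍ} (hF : MemLp F 2 volume)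
    {e : ℍ} (he : ‖e‖ = 1) :
    eLpNorm (componentFourier I hF e) 2 volume ≤ 2 * eLpNorm F 2 volume :=
  (eLpNorm_fourier_toLp _).trans_le (eLpNorm_sliceCoord_mul_le hI F he)

/-- Left multiplication by the ℂ_I-valued kernel respects the splitting, so each component is
transformed separately. The argument t/(2π) reflects the kernel e^{-2πixξ} of 𝓕; a.e. uniqueness
identifies the chosen representative. -/
theorem quaternionFourierL2_ae_eq (hI : I ∈ imagUnitSphere) (hJ : J ∈ imagUnitSphere)
    (hIJ : (I * J).re = 0) {F : ℝ → ℍ} (hF : MemLp F 2 volume) :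
    quaternionFourierL2 I F hI hF =ᵐ[volume] fun t => (Real.sqrt (2 * Real.pi))⁻¹ •
      (sliceEmbedding hI (componentFourier I hF 1 (t / (2 * Real.pi))) +
        sliceEmbedding hI (componentFourier I hF (-J) (t / (2 * Real.pi))) * J) := by
  have hm : ∀ e e' : ℍ, MemLp (fun x => sliceEmbedding hI (sliceCoord I (F x * e)) * e') 2 volume :=
    fun e e' => ((ContinuousLinearMap.mul ℝ ℍ).flip e' ∘L sliceEmbeddingCLM hI).comp_memLp'
      (memLp_sliceCoord_mul I hF e)
  have t := (isPlancherelTransform_component (memLp_sliceCoord_mul I hF 1) (sliceEmbedding hI)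
    (sliceEmbedding_I hI) 1).add hI (hm _ _) (hm _ _)
    (isPlancherelTransform_component (memLp_sliceCoord_mul I hF (-J)) (sliceEmbedding hI)
    (sliceEmbedding_I hI) J)
  have e : (fun x => sliceEmbedding hI (sliceCoord I (F x * 1)) * 1 +
      sliceEmbedding hI (sliceCoord I (F x * -J)) * J) = F := by
    ext1 x
    rw [mul_one, mul_one, sliceEmbedding_sliceCoord_add hI hJ hIJ]
  rw [e] at t
  refine ((quaternionFourierL2_spec I F hI hF).ae_unique hI hF t).trans (.of_forall fun s => ?_)
  beta_reduce
  rw [← smul_add, mul_one (sliceEmbedding hI _)]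
  rfl

theorem ae_eq_zero_iff_componentFourier (hI : I ∈ imagUnitSphere) (hJ : J ∈ imagUnitSphere)
    (hIJ : (I * J).re = 0) {F : ℝ → ℍ} (hF : MemLp F 2 volume) :
    (∀ᵐ t ∂(volume : Measure ℝ), A < |t| → quaternionFourierL2 I F hI hF t = 0) ↔
      (∀ᵐ ξ ∂(volume : Measure ℝ), A < 2 * Real.pi * |ξ| → componentFourier I hF 1 ξ = 0) ∧
      ∀ᵐ ξ ∂(volume : Measure ℝ), A < 2 * Real.pi * |ξ| → componentFourier I hF (-J) ξ = 0 := by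
  have hpi : (0 : ℝ) < 2 * Real.pi := by positivity
  have hrep := quaternionFourierL2_ae_eq hI hJ hIJ hF
  have hc : (Real.sqrt (2 * Real.pi))⁻¹ ≠ 0 := by positivity
  constructor
  · intro h
    have h' : ∀ᵐ t ∂(volume : Measure ℝ), A < |t| →
        componentFourier I hF 1 (t / (2 * Real.pi)) = 0 ∧
        componentFourier I hF (-J) (t / (2 * Real.pi)) = 0 := by
      filter_upwards [h, hrep] with t h1 h2 hA
      have h3 := h1 hA
      rw [h2, smul_eq_zero_iff_right hc] at h3
      have h4 : componentFourier I hF 1 (t / (2 * Real.pi)) = 0 := by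
        have := congrArg (sliceCoord I) h3
        rwa [map_add, sliceCoord_sliceEmbedding hI, sliceCoord_sliceEmbedding_mul hI hJ.1 hIJ,
          add_zero, map_zero] at this
      refine ⟨h4, ?_⟩
      rw [h4, map_zero, zero_add] at h3
      have hJ0 : J ≠ 0 := fun h0 => by simpa [h0] using hJ.2
      have := congrArg (sliceCoord I) ((mul_eq_zero_iff_right hJ0).1 h3)
      rwa [sliceCoord_sliceEmbedding hI, map_zero] at this
    -- Dividing by (2π)⁻¹ undoes the rescaling t/(2π).
    have h'' := ae_comp_div h' (inv_ne_zero hpi.ne')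
    have : ∀ᵐ ξ ∂(volume : Measure ℝ), A < 2 * Real.pi * |ξ| →
        componentFourier I hF 1 ξ = 0 ∧ componentFourier I hF (-J) ξ = 0 := by
      filter_upwards [h''] with ξ hξ hA
      rw [div_inv_eq_mul, mul_div_cancel_right₀ _ hpi.ne', abs_mul, abs_of_pos hpi] at hξ
      exact hξ (by linarith)
    exact ⟨this.mono fun ξ h hA => (h hA).1, this.mono fun ξ h hA => (h hA).2⟩
  · rintro ⟨h1, h2⟩
    filter_upwards [hrep, ae_comp_div h1 hpi.ne', ae_comp_div h2 hpi.ne'] with t h3 h4 h5 hA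
    have : A < 2 * Real.pi * |t / (2 * Real.pi)| := by
      rw [abs_div, abs_of_pos hpi, mul_div_cancel₀ _ hpi.ne']
      exact hA
    rw [h3, h4 this, h5 this]
    simp

theorem intervalIntegrable_exp_mul_quaternionFourierL2 (hI : I ∈ imagUnitSphere) {F : ℝ → ℍ}
    (hF : MemLp F 2 volume) (q : ℍ) (a b : ℝ) :
    IntervalIntegrable (fun t : ℝ => NormedSpace.exp (q * (t : ℍ)) *
      quaternionFourierL2 I F hI hF t) volume a b := by
  have hG := (quaternionFourierL2_spec I F hI hF).1
  have hi : IntervalIntegrable (quaternionFourierL2 I F hI hF) volume a b :=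
    ((hG.locallyIntegrable (by norm_num)).integrableOn_isCompact isCompact_uIcc).intervalIntegrable
  refine hi.continuousOn_mul (Continuous.continuousOn ?_)
  let +nondep : NormedAlgebra ℚ ℍ := .restrictScalars ℚ ℝ ℍ
  exact NormedSpace.exp_continuous.comp (continuous_const.mul Quaternion.continuous_coe)

end QuaternionTransform

/-! ### Paley–Wiener on each slice, reassembled -/

section PaleyWiener

variable {I J : ℍ} {A C : ℝ} {f : ℍ → ℍ}

theorem sliceComponent_ofReal (hI : I ∈ imagUnitSphere) (f : ℍ → ℍ) (e : ℍ) (x : ℝ) :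
    sliceComponent hI f e x = sliceCoord I (f (x : ℍ) * e) := by
  rw [sliceComponent, sliceEmbedding_ofReal]

theorem componentFourier_ae_eq_zero (hf : LeftSliceRegularOn f Set.univ)
    (hL2 : MemLp (fun x : ℝ => f (x : ℍ)) 2 volume) (hA : 0 ≤ A)
    (hC : ∀ q : ℍ, ‖f q‖ ≤ C * Real.exp (A * ‖q‖)) (hI : I ∈ imagUnitSphere) {e : ℍ}
    (he : ‖e‖ = 1) :
    ∀ᵐ ξ ∂(volume : Measure ℝ), A < 2 * Real.pi * |ξ| → componentFourier I hL2 e ξ = 0 := by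
  have hC0 : 0 ≤ C := by simpa using (norm_nonneg _).trans (hC 0)
  have hL : MemLp (fun x : ℝ => sliceComponent hI f e x) 2 volume := by
    simpa only [sliceComponent_ofReal] using memLp_sliceCoord_mul I hL2 e
  have := fourier_toLp_ae_eq_zero (C := 2 * C) (hf.differentiable_sliceComponent hI e) hA
    (by positivity) (fun z => ?_) hL
  · simp only [sliceComponent_ofReal] at this
    exact this
  · have h1 := norm_sliceCoord_le hI (f (sliceEmbedding hI z) * e)
    rw [norm_mul, he, mul_one] at h1
    have h2 := hC (sliceEmbedding hI z)
    rw [norm_sliceEmbedding] at h2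
    rw [sliceComponent]
    linarith

theorem sliceComponent_eq_integral (hf : LeftSliceRegularOn f Set.univ)
    (hL2 : MemLp (fun x : ℝ => f (x : ℍ)) 2 volume) (hI : I ∈ imagUnitSphere) {e : ℍ}
    (hz : ∀ᵐ ξ ∂(volume : Measure ℝ), A < 2 * Real.pi * |ξ| → componentFourier I hL2 e ξ = 0)
    (z : ℂ) :
    sliceComponent hI f e z = ∫ ξ : ℝ, Complex.exp (2 * Real.pi * Complex.I * z * ξ) *
      componentFourier I hL2 e ξ := by
  have hL : MemLp (fun x : ℝ => sliceComponent hI f e x) 2 volume := by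
    simpa only [sliceComponent_ofReal] using memLp_sliceCoord_mul I hL2 e
  have := eq_integral_exp_mul_fourier (A := A) (hf.differentiable_sliceComponent hI e) hL
    (by simp only [sliceComponent_ofReal]; exact hz) z
  simp only [sliceComponent_ofReal] at this
  exact this

theorem apply_sliceEmbedding_eq (hI : I ∈ imagUnitSphere) (hJ : J ∈ imagUnitSphere)
    (hIJ : (I * J).re = 0) (f : ℍ → ℍ) (z : ℂ) :
    f (sliceEmbedding hI z) = sliceEmbedding hI (sliceComponent hI f 1 z) +
      sliceEmbedding hI (sliceComponent hI f (-J) z) * J := by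
  rw [sliceComponent, sliceComponent, mul_one, sliceEmbedding_sliceCoord_add hI hJ hIJ]

/-- Each component is inverted in ℂ. The kernel lies in ℂ_I, so it passes through the slice
embedding and the two inversion formulas recombine. -/
theorem apply_sliceEmbedding_eq_integral (hf : LeftSliceRegularOn f Set.univ)
    (hL2 : MemLp (fun x : ℝ => f (x : ℍ)) 2 volume) (hA : 0 ≤ A) (hI : I ∈ imagUnitSphere)
    (hz : ∀ᵐ t ∂(volume : Measure ℝ), A < |t| →
      quaternionFourierL2 I (fun x : ℝ => f (x : ℍ)) hI hL2 t = 0) (z : ℂ) :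
    f (sliceEmbedding hI z) = (Real.sqrt (2 * Real.pi))⁻¹ • ∫ t in (-A)..A,
      NormedSpace.exp (I * sliceEmbedding hI z * (t : ℍ)) *
        quaternionFourierL2 I (fun x : ℝ => f (x : ℍ)) hI hL2 t := by
  obtain ⟨J, hJ, hIJ⟩ := exists_orthogonal_imagUnit hI
  obtain ⟨hz1, hz2⟩ := (ae_eq_zero_iff_componentFourier hI hJ hIJ hL2).1 hz
  have hpi : (0 : ℝ) < 2 * Real.pi := by positivity
  set c := (Real.sqrt (2 * Real.pi))⁻¹ with hc
  -- One c comes from the formula, one from the normalisation of the transform, and 2π from the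
  -- substitution t = 2πξ.
  have hcc : c * (c * (2 * Real.pi)) = 1 := by
    rw [← mul_assoc, ← sq, hc, inv_pow, Real.sq_sqrt hpi.le, inv_mul_cancel₀ hpi.ne']
  set K : ℍ → ℝ → ℂ := fun e ξ => Complex.exp (2 * Real.pi * Complex.I * z * ξ) *
    componentFourier I hL2 e ξ with hK
  have hker : ∀ t : ℝ, NormedSpace.exp (I * sliceEmbedding hI z * (t : ℍ)) =
      sliceEmbedding hI (Complex.exp (2 * Real.pi * Complex.I * z * ((t / (2 * Real.pi) : ℝ) : ℂ))) := by
    intro t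
    rw [sliceEmbedding_exp]
    congr 1
    have : (2 * Real.pi * Complex.I * z * ((t / (2 * Real.pi) : ℝ) : ℂ) : ℂ)
        = Complex.I * z * (t : ℂ) := by
      push_cast
      field_simp
    rw [this, map_mul, map_mul, sliceEmbedding_I, sliceEmbedding_ofReal]
  have hcov : ∀ e : ℍ, (∀ᵐ ξ ∂(volume : Measure ℝ), A < 2 * Real.pi * |ξ| →
      componentFourier I hL2 e ξ = 0) →
      Integrable (fun t : ℝ => K e (t / (2 * Real.pi))) volume ∧
      ∫ t : ℝ, K e (t / (2 * Real.pi)) = (2 * Real.pi) • sliceComponent hI f e z := by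
    intro e he
    refine ⟨(integrable_exp_mul (memLp_componentFourier I hL2 e) he z).comp_div hpi.ne', ?_⟩
    rw [Measure.integral_comp_div, abs_of_pos hpi, sliceComponent_eq_integral hf hL2 hI he]
  obtain ⟨hi1, he1⟩ := hcov 1 hz1
  obtain ⟨hi2, he2⟩ := hcov (-J) hz2
  let T : ℂ →L[ℝ] ℍ := (ContinuousLinearMap.mul ℝ ℍ).flip J ∘L sliceEmbeddingCLM hI
  have hT : ∀ w, T w = sliceEmbedding hI w * J := fun w => rfl
  have hint : ∫ t in (-A)..A, NormedSpace.exp (I * sliceEmbedding hI z * (t : ℍ)) *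
        quaternionFourierL2 I (fun x : ℝ => f (x : ℍ)) hI hL2 t
      = ∫ t : ℝ, c • (sliceEmbeddingCLM hI (K 1 (t / (2 * Real.pi)))
        + T (K (-J) (t / (2 * Real.pi)))) := by
    rw [intervalIntegral.integral_of_le (by linarith), ← integral_Icc_eq_integral_Ioc,
      setIntegral_eq_integral_of_ae_compl_eq_zero]
    · refine integral_congr_ae ?_
      filter_upwards [quaternionFourierL2_ae_eq hI hJ hIJ hL2] with t ht
      rw [ht, hker, mul_smul_comm, mul_add, ← mul_assoc, ← map_mul, ← map_mul, hT,
        sliceEmbeddingCLM_apply]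
    · filter_upwards [hz] with t ht htA
      rw [Set.mem_Icc, ← abs_le, not_le] at htA
      rw [ht htA, mul_zero]
  rw [hint, integral_smul, integral_add ((sliceEmbeddingCLM hI).integrable_comp hi1)
    (T.integrable_comp hi2), ContinuousLinearMap.integral_comp_comm _ hi1,
    ContinuousLinearMap.integral_comp_comm _ hi2, he1, he2, map_smul, map_smul, ← smul_add,
    smul_smul, smul_smul, mul_assoc, hcc, one_smul, hT, sliceEmbeddingCLM_apply,
    ← apply_sliceEmbedding_eq hI hJ hIJ f]

theorem exists_exponential_bound (hf : LeftSliceRegularOn f Set.univ)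
    (hL2 : MemLp (fun x : ℝ => f (x : ℍ)) 2 volume) (hA : 0 ≤ A)
    (hz : ∀ (I : ℍ) (hI : I ∈ imagUnitSphere), ∀ᵐ t ∂(volume : Measure ℝ), A < |t| →
      quaternionFourierL2 I (fun x : ℝ => f (x : ℍ)) hI hL2 t = 0) :
    ∃ C : ℝ, ∀ q : ℍ, ‖f q‖ ≤ C * Real.exp (A * ‖q‖) := by
  -- D involves only the L² norm of f on ℝ, so it serves all slices at once; the final constant 2D
  -- accounts for the two components.
  set D : ℝ := (2 * eLpNorm (fun x : ℝ => f (x : ℍ)) 2 volume *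
    ENNReal.ofReal (A / Real.pi) ^ (1 / 2 : ℝ)).toReal with hD
  refine ⟨2 * D, fun q => ?_⟩
  obtain ⟨I, hI, z, rfl⟩ := exists_sliceEmbedding_eq q
  obtain ⟨J, hJ, hIJ⟩ := exists_orthogonal_imagUnit hI
  obtain ⟨hz1, hz2⟩ := (ae_eq_zero_iff_componentFourier hI hJ hIJ hL2).1 (hz I hI)
  have hb : ∀ e : ℍ, ‖e‖ = 1 → (∀ᵐ ξ ∂(volume : Measure ℝ), A < 2 * Real.pi * |ξ| →
      componentFourier I hL2 e ξ = 0) → ‖sliceComponent hI f e z‖ ≤ Real.exp (A * ‖z‖) * D := by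
    intro e he hze
    rw [sliceComponent_eq_integral hf hL2 hI hze]
    refine (norm_integral_exp_mul_le (memLp_componentFourier I hL2 e) hze z).trans ?_
    have h1 : (eLpNorm (componentFourier I hL2 e) 2 volume *
        ENNReal.ofReal (A / Real.pi) ^ (1 / 2 : ℝ)).toReal ≤ D := by
      refine ENNReal.toReal_mono ?_ ?_
      · exact ENNReal.mul_ne_top (ENNReal.mul_ne_top (by norm_num) hL2.2.ne)
          (ENNReal.rpow_ne_top_of_nonneg (by norm_num) ENNReal.ofReal_ne_top)
      · gcongr
        exact eLpNorm_componentFourier_le hI hL2 he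
    have h2 := Complex.abs_im_le_norm z
    gcongr
  rw [apply_sliceEmbedding_eq hI hJ hIJ f, norm_sliceEmbedding]
  refine (norm_add_le _ _).trans ?_
  rw [norm_mul, norm_sliceEmbedding, norm_sliceEmbedding, hJ.2, mul_one]
  have h1 := hb 1 norm_one hz1
  have h2 := hb (-J) (by rw [norm_neg, hJ.2]) hz2
  linarith

end PaleyWiener

end

theorem theorem3p1 (f : ℍ → ℍ) (hf : LeftSliceRegularOn f Set.univ)
    (hL2 : MemLp (fun x : ℝ => f (x : ℍ)) 2 volume) (A : ℝ) (hA : 0 < A) :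
    ((∃ C : ℝ, ∀ q : ℍ, ‖f q‖ ≤ C * Real.exp (A * ‖q‖)) ↔
      ∀ (I : ℍ) (hI : I ∈ imagUnitSphere),
        essentialSupport (quaternionFourierL2 I (fun x : ℝ => f (x : ℍ)) hI hL2)
          ⊆ Set.Icc (-A) A) ∧
    (((∃ C : ℝ, ∀ q : ℍ, ‖f q‖ ≤ C * Real.exp (A * ‖q‖)) ∨
      ∀ (I : ℍ) (hI : I ∈ imagUnitSphere),
        essentialSupport (quaternionFourierL2 I (fun x : ℝ => f (x : ℍ)) hI hL2)
          ⊆ Set.Icc (-A) A) →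
      ∀ (I : ℍ) (hI : I ∈ imagUnitSphere) (x y : ℝ),
        IntervalIntegrable (fun t : ℝ =>
          NormedSpace.exp (I * ((x : ℍ) + I * (y : ℍ)) * (t : ℍ)) *
            quaternionFourierL2 I (fun x : ℝ => f (x : ℍ)) hI hL2 t) volume (-A) A ∧
        f ((x : ℍ) + I * (y : ℍ)) = (Real.sqrt (2 * Real.pi))⁻¹ •
          ∫ t in (-A)..A, NormedSpace.exp (I * ((x : ℍ) + I * (y : ℍ)) * (t : ℍ)) *
            quaternionFourierL2 I (fun x : ℝ => f (x : ℍ)) hI hL2 t) := by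
  have hforward : (∃ C : ℝ, ∀ q : ℍ, ‖f q‖ ≤ C * Real.exp (A * ‖q‖)) →
      ∀ (I : ℍ) (hI : I ∈ imagUnitSphere),
        essentialSupport (quaternionFourierL2 I (fun x : ℝ => f (x : ℍ)) hI hL2)
          ⊆ Set.Icc (-A) A := by
    rintro ⟨C, hC⟩ I hI
    obtain ⟨J, hJ, hIJ⟩ := exists_orthogonal_imagUnit hI
    exact essentialSupport_subset_Icc_iff.2 ((ae_eq_zero_iff_componentFourier hI hJ hIJ hL2).2
      ⟨componentFourier_ae_eq_zero hf hL2 hA.le hC hI norm_one,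
        componentFourier_ae_eq_zero hf hL2 hA.le hC hI (by rw [norm_neg, hJ.2])⟩)
  refine ⟨⟨hforward, fun h => exists_exponential_bound hf hL2 hA.le fun I hI =>
    essentialSupport_subset_Icc_iff.1 (h I hI)⟩, fun h I hI x y =>
    ⟨intervalIntegrable_exp_mul_quaternionFourierL2 hI hL2 _ _ _, ?_⟩⟩
  have hz := essentialSupport_subset_Icc_iff.1 (h.elim hforward id I hI)
  have key := apply_sliceEmbedding_eq_integral hf hL2 hA.le hI hz ⟨x, y⟩
  simpa only [sliceEmbedding_apply] using key
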